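/- Conventions. A valued field $(K,v)$ is a field with a (Krull) valuation, possibly trivial and of arbitrary rank; $vK$ is its value group and $Kv$ its residue field. An extension $(L|K,v)$ of valued fields is immediate if the canonical embeddings $vK\to vL$ and $Kv\to Lv$ are onto. $(K,v)$ is henselian if its valuation ring satisfies Hensel's Lemma. An algebraic extension $(L|K,v)$ of a henselian field $(K,v)$ is tame if every finite subextension $E|K$ satisfies: $(vE:vK)$ is not divisible by $\operatorname{char} Kv$; $Ev|Kv$ is separable; and $[E:K]=(vE:vK)[Ev:Kv]$. A tame field (resp. separably tame field) is a henselian field all of whose algebraic (resp. separable-algebraic) extensions are tame. A function field $F|K$ is a finitely generated field extension of transcendence degree $\geq 1$; it is separable if it has a separating transcendence basis. A maximal immediate algebraic (resp. separable-algebraic) extension of $(F,v)$ is an immediate algebraic (resp. separable-algebraic) extension $(N,v)$ of $(F,v)$ such that no proper extension of $(N,v)$ is again an immediate algebraic (resp. separable-algebraic) extension of $(F,v)$. Proposition. Let $(F|K,v)$ be an immediate valued function field. (a) If $(K,v)$ is a tame field, then there exists an immediate extension $(N,v)$ of $(F,v)$ which is a tame field. More precisely, $(F,v)$ has a maximal immediate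 algebraic extension, and every maximal immediate algebraic extension $(N,v)$ of $(F,v)$ is a tame field. (b) If $(K,v)$ is a separably tame field and $F|K$ is separable, then there exists an immediate separable extension $(N,v)$ of $(F,v)$ which is a separably tame field. More precisely, $(F,v)$ has a maximal immediate separable-algebraic extension, and every maximal immediate separable-algebraic extension $(N,v)$ of $(F,v)$ is a separably tame field. -/

import Mathlib

universe u

namespace HenselRat

open IsLocalRing

section Basic

variable {K : Type*} [Field K] {Γ : Type*} [LinearOrderedCommGroupWithZero Γ]

/-- The residue field `Kv` of a valued field `(K, v)`. -/
abbrev Residue (v : Valuation K Γ) : Type _ := ResidueField v.valuationSubring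

/-- The value group `vK` of a valued field `(K, v)`, written multiplicatively, as a subgroup of
the group of nonzero elements of the target of `v`. -/
abbrev valueGrp (v : Valuation K Γ) : Subgroup Γˣ :=
  MonoidWithZeroHom.valueGroup (.ofClass v)

/-- `(K, v)` is henselian: its valuation ring satisfies Hensel's Lemma. -/
def IsHenselian (v : Valuation K Γ) : Prop := HenselianLocalRing v.valuationSubring

end Basic

section Extension

variable {K L : Type*} [Field K] [Field L] [Algebra K L]
  {Γ Γ' : Type*} [LinearOrderedCommGroupWithZero Γ] [LinearOrderedCommGroupWithZero Γ']

/-- If `w` on `L` extends `v` on `K`, so does its restriction to an intermediate field. -/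
instance hasExtension_comap_intermediateField (v : Valuation K Γ) (w : Valuation L Γ')
    [h : v.HasExtension w] (E : IntermediateField K L) :
    v.HasExtension (w.comap (algebraMap E L)) where
  val_isEquiv_comap := h.val_isEquiv_comap

/-- The ramification index `(wL : vK)`, where `vK` is identified with its image in `wL`, the value
group of the restriction of `w` to `K`. -/
noncomputable def ramificationIndex (v : Valuation K Γ) (w : Valuation L Γ')
    [v.HasExtension w] : ℕ :=
  (valueGrp (w.comap (algebraMap K L))).relIndex (valueGrp w)

/-- The residue degree `[Lw : Kv]`. -/
noncomputable def residueDegree (v : Valuation K Γ) (w : Valuation L Γ') [v.HasExtension w] : ℕ :=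
  Module.finrank (Residue v) (Residue w)

/-- `(L, w)` is an immediate extension of `(K, v)`: the canonical embeddings of value groups
and of residue fields are onto. -/
structure IsImmediate (v : Valuation K Γ) (w : Valuation L Γ') [v.HasExtension w] : Prop where
  valueGrp_eq : valueGrp (w.comap (algebraMap K L)) = valueGrp w
  residue_surjective : Function.Surjective (algebraMap (Residue v) (Residue w))

/-- The conditions that a finite extension `(E, w)` of `(K, v)` has to satisfy in a
tame extension. -/
structure IsFiniteTame (v : Valuation K Γ) (w : Valuation L Γ') [v.HasExtension w] : Prop where
  not_dvd : ¬ ringChar (Residue v) ∣ ramificationIndex v w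
  separable : Algebra.IsSeparable (Residue v) (Residue w)
  defectless : Module.finrank K L = ramificationIndex v w * residueDegree v w

/-- The algebraic extension `(L, w)` of `(K, v)` is tame: every finite subextension satisfies
the conditions above. -/
def IsTameExtension (v : Valuation K Γ) (w : Valuation L Γ') [v.HasExtension w] : Prop :=
  ∀ E : IntermediateField K L, FiniteDimensional K E →
    IsFiniteTame v (w.comap (algebraMap E L))

end Extension

section Tame

variable {K : Type u} [Field K] {Γ : Type*} [LinearOrderedCommGroupWithZero Γ]

/-- A tame field: a henselian field all of whose algebraic extensions are tame. Every algebraic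
extension of `K`, and its value group, has a copy in the universe of `K`. -/
structure IsTameField (v : Valuation K Γ) : Prop where
  henselian : IsHenselian v
  tame : ∀ (L : Type u) [Field L] [Algebra K L] (Γ' : Type u) [LinearOrderedCommGroupWithZero Γ']
    (w : Valuation L Γ') [v.HasExtension w], Algebra.IsAlgebraic K L → IsTameExtension v w

/-- A separably tame field: a henselian field all of whose separable-algebraic extensions
are tame. -/
structure IsSeparablyTameField (v : Valuation K Γ) : Prop where
  henselian : IsHenselian v
  tame : ∀ (L : Type u) [Field L] [Algebra K L] (Γ' : Type u) [LinearOrderedCommGroupWithZero Γ']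
    (w : Valuation L Γ') [v.HasExtension w], Algebra.IsSeparable K L → IsTameExtension v w

end Tame

section FunctionField

variable (K F : Type*) [Field K] [Field F] [Algebra K F]

/-- An algebraic function field: a finitely generated field extension of transcendence degree
at least `1`. -/
structure IsFunctionField : Prop where
  fg : (⊤ : IntermediateField K F).FG
  one_le_trdeg : 1 ≤ Algebra.trdeg K F

/-- `F | K` is separably generated, that is, has a separating transcendence basis. For finitely
generated field extensions this is separability in the sense of not necessarily
algebraic extensions. -/
def IsSeparablyGenerated : Prop :=
  ∃ T : Set F, IsTranscendenceBasis K ((↑) : T → F) ∧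
    Algebra.IsSeparable (IntermediateField.adjoin K T) F

end FunctionField

section Maximal

variable {F N : Type u} [Field F] [Field N] [Algebra F N]
  {Γ Γ' : Type*} [LinearOrderedCommGroupWithZero Γ] [LinearOrderedCommGroupWithZero Γ']

/-- `(N, w)` is a maximal immediate algebraic extension of `(F, v)`: no proper extension of
`(N, w)` is an immediate algebraic extension of `(F, v)`. -/
structure IsMaximalImmediateAlgebraic (v : Valuation F Γ) (w : Valuation N Γ')
    [v.HasExtension w] : Prop where
  algebraic : Algebra.IsAlgebraic F N
  immediate : IsImmediate v w
  maximal : ∀ (M : Type u) [Field M] [Algebra F M] [Algebra N M] [IsScalarTower F N M]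
    (Δ : Type u) [LinearOrderedCommGroupWithZero Δ] (w' : Valuation M Δ)
    [w.HasExtension w'] [v.HasExtension w'],
    Algebra.IsAlgebraic F M → IsImmediate v w' → Function.Surjective (algebraMap N M)

/-- `(N, w)` is a maximal immediate separable-algebraic extension of `(F, v)`: no proper extension
of `(N, w)` is an immediate separable-algebraic extension of `(F, v)`. -/
structure IsMaximalImmediateSeparable (v : Valuation F Γ) (w : Valuation N Γ')
    [v.HasExtension w] : Prop where
  separable : Algebra.IsSeparable F N
  immediate : IsImmediate v w
  maximal : ∀ (M : Type u) [Field M] [Algebra F M] [Algebra N M] [IsScalarTower F N M]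
    (Δ : Type u) [LinearOrderedCommGroupWithZero Δ] (w' : Valuation M Δ)
    [w.HasExtension w'] [v.HasExtension w'],
    Algebra.IsSeparable F M → IsImmediate v w' → Function.Surjective (algebraMap N M)

end Maximal

end HenselRat

/-! Let $p$ be the residue characteristic. The argument runs through two properties of the base: its
value group is $p$-divisible and its residue field is perfect. An immediate function field cannot
live over a trivially valued base, so $K$ contains $\eta\neq 0$ of arbitrarily small value. Roots of
$X^p-\eta X-c$ generate finite separable, hence tame, extensions of $K$, yet they behave like $p$-th
roots of $c$ in values and residues; tameness then forces these values and residues into $K$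
(`IsSeparablyTameField.isResidueCharDivisible`, `IsSeparablyTameField.perfectField_residue`). Both
properties depend only on the value group and the residue field, so they pass to $F$ and to its
immediate extension $N$.

The core is `isSeparablyTameField_of_maximal`: a field $N$ with both properties and no proper
immediate separable-algebraic extension is separably tame. Embed $N$ in a spherically complete
immediate extension $L$. By maximality $N$ is relatively separably closed in $L$; since $L$ is
henselian, so is $N$. For a finite separable $E|N$ the compositum $M=EL$ has degree $[M:L]=[E:N]$,
is again spherically complete, hence henselian, and carries a common extension of the valuations
(`exists_compositum`, `exists_common_extension`). Hensel's Lemma in $M$, with divisibility and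
perfectness, shows that $M|E$ is immediate (`approxBy_of_isHenselian`). Now $ef$ elements of $E$,
chosen from representatives of value cosets and residues, approximate $E$ over $N$, hence $M$ over
$L$; over a spherically complete field an approximating finite set spans. Thus $[E:N]=[M:L]\le ef$,
and $ef\le [E:N]$ always holds. The other tameness conditions follow from divisibility and
perfectness.

The field $L$ comes from Kaplansky's method: a nest of balls without common point defines a proper
immediate extension through the eventual values of polynomials. Zorn's Lemma inside an algebraically
closed field too large to be algebraic over an immediate extension of $N$ therefore ends in a field
without such nests. Maximal immediate algebraic (separable-algebraic) extensions of $F$ come from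
the same Zorn argument inside the algebraic (separable) closure. In the tame case the perfect
closure of $N$ is immediate over $N$, so $N$ is perfect and every algebraic extension of it is
separable. -/

namespace HenselRat
open IsLocalRing

/-! ### Immediate extensions as approximation -/

section Approx

variable {N L : Type*} [Field N] [Field L] [Algebra N L]
  {Γ Γ' : Type*} [LinearOrderedCommGroupWithZero Γ] [LinearOrderedCommGroupWithZero Γ']

theorem mem_valueGrp {w : Valuation L Γ} {γ : Γˣ} : γ ∈ valueGrp w ↔ ∃ x, w x = γ := by
  constructor
  · intro h
    have : (γ : Γ) ∈ Units.val '' (valueGrp w : Set Γˣ) := ⟨γ, h, rfl⟩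
    rw [MonoidWithZeroHom.valueGroup_eq_range] at this
    exact this.1
  · rintro ⟨x, hx⟩
    exact MonoidWithZeroHom.mem_valueGroup _ ⟨x, hx⟩

variable (N) in
/-- Every nonzero element of `L` is approximated by an element of `N` up to an error of smaller
value. For an extension of valued fields, this says that the extension is immediate. -/
def ApproxBy (w : Valuation L Γ) : Prop :=
  ∀ x : L, x ≠ 0 → ∃ c : N, w (x - algebraMap N L c) < w x

theorem ApproxBy.isEquiv {w : Valuation L Γ} {w' : Valuation L Γ'} (h : ApproxBy N w)
    (e : w.IsEquiv w') : ApproxBy N w' := fun x hx ↦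
  (h x hx).imp fun _ hc ↦ e.lt_iff_lt.1 hc

theorem val_eq_of_sub_lt {w : Valuation L Γ} {x c : L} (h : w (x - c) < w x) : w c = w x := by
  have := Valuation.map_sub_eq_of_lt_right w h
  simpa using this

theorem ApproxBy.exists_val_eq {w : Valuation L Γ} (h : ApproxBy N w) (x : L) :
    ∃ c : N, w (algebraMap N L c) = w x := by
  by_cases hx : x = 0
  · exact ⟨0, by simp [hx]⟩
  · obtain ⟨c, hc⟩ := h x hx
    exact ⟨c, val_eq_of_sub_lt hc⟩

theorem ApproxBy.exists_sub_lt_one {w : Valuation L Γ} (h : ApproxBy N w) {x : L} (hx : w x ≤ 1) :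
    ∃ c : N, w (x - algebraMap N L c) < 1 := by
  by_cases hx0 : x = 0
  · exact ⟨0, by simp [hx0]⟩
  · obtain ⟨c, hc⟩ := h x hx0
    exact ⟨c, hc.trans_le hx⟩

theorem ApproxBy.trans {M : Type*} [Field M] [Algebra N M] [Algebra L M] [IsScalarTower N L M]
    {w : Valuation M Γ} (h : ApproxBy L w)
    (h' : ApproxBy N (w.comap (algebraMap L M))) : ApproxBy N w := by
  intro x hx
  obtain ⟨y, hy⟩ := h x hx
  have hyx := val_eq_of_sub_lt hy
  have hy0 : y ≠ 0 := by
    rintro rfl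
    simp at hy
  obtain ⟨c, hc⟩ := h' y hy0
  refine ⟨c, ?_⟩
  have : x - algebraMap N M c = (x - algebraMap L M y) + algebraMap L M (y - algebraMap N L c) := by
    rw [map_sub, ← IsScalarTower.algebraMap_apply]; ring
  rw [this]
  refine Valuation.map_add_lt _ hy ?_
  rw [← hyx]
  exact hc

theorem ApproxBy.tower_bot {M : Type*} [Field M] [Algebra N M] [Algebra L M] [IsScalarTower N L M]
    {w : Valuation M Γ} (h : ApproxBy N w) : ApproxBy N (w.comap (algebraMap L M)) := by
  intro x hx
  obtain ⟨c, hc⟩ := h (algebraMap L M x) (by simpa using hx)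
  refine ⟨c, ?_⟩
  simpa [IsScalarTower.algebraMap_apply N L M] using hc

theorem residue_eq_iff {w : Valuation L Γ} {x y : w.valuationSubring} :
    residue w.valuationSubring x = residue w.valuationSubring y ↔ w ((x : L) - y) < 1 := by
  rw [← sub_eq_zero, ← map_sub, residue_eq_zero_iff, Valuation.mem_maximalIdeal_iff]
  rfl

/-- Choose $c\in N$ with the value of $x$ and $d\in N$ with the residue of $x/c$; then $dc$
approximates $x$. Conversely, an approximation of $x$ shares its value and, when $x$ is integral,
its residue. -/
theorem isImmediate_iff_approxBy (v : Valuation N Γ) (w : Valuation L Γ') [v.HasExtension w] :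
    IsImmediate v w ↔ ApproxBy N w := by
  constructor
  · intro h x hx
    have hwx : w x ≠ 0 := by simpa using hx
    obtain ⟨c, hc⟩ : ∃ c : N, w (algebraMap N L c) = w x := by
      have : Units.mk0 (w x) hwx ∈ valueGrp w := mem_valueGrp.2 ⟨x, rfl⟩
      rw [← h.valueGrp_eq] at this
      exact mem_valueGrp.1 this
    have hc0 : w (algebraMap N L c) ≠ 0 := hc ▸ hwx
    have hu : w (x / algebraMap N L c) = 1 := by rw [map_div₀, hc, div_self hwx]
    obtain ⟨d, hd⟩ := h.residue_surjective (residue _ ⟨x / algebraMap N L c, hu.le⟩)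
    obtain ⟨d, rfl⟩ := residue_surjective d
    rw [Valuation.HasExtension.algebraMap_residue_eq_residue_algebraMap, eq_comm,
      residue_eq_iff] at hd
    refine ⟨d * c, ?_⟩
    have : x - algebraMap N L (d * c) =
        (x / algebraMap N L c - algebraMap N L d) * algebraMap N L c := by
      have : algebraMap N L c ≠ 0 := by simpa using hc0
      rw [map_mul]; field_simp
    rw [this, map_mul, ← hc]
    exact mul_lt_of_lt_one_left (zero_lt_iff.2 hc0) hd
  · intro h
    refine ⟨?_, ?_⟩
    · ext γ
      rw [mem_valueGrp, mem_valueGrp]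
      constructor
      · rintro ⟨x, hx⟩
        exact ⟨_, hx⟩
      · rintro ⟨x, hx⟩
        obtain ⟨c, hc⟩ := h.exists_val_eq x
        exact ⟨c, hc.trans hx⟩
    · intro r
      obtain ⟨r, rfl⟩ := residue_surjective r
      obtain ⟨c, hc⟩ := h.exists_sub_lt_one r.2
      have hc1 : v c ≤ 1 := by
        rw [← Valuation.HasExtension.val_map_le_one_iff v w]
        have : algebraMap N L c = r - (r - algebraMap N L c) := by ring
        rw [this]
        exact (Valuation.map_sub _ _ _).trans (max_le r.2 hc.le)
      refine ⟨residue _ ⟨c, hc1⟩, ?_⟩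
      rw [Valuation.HasExtension.algebraMap_residue_eq_residue_algebraMap, eq_comm, residue_eq_iff]
      exact hc

end Approx

/-! ### Extending valuations -/

section Extend

variable {K L : Type*} [Field K] [Field L] [Algebra K L]
  {Γ Γ' : Type*} [LinearOrderedCommGroupWithZero Γ] [LinearOrderedCommGroupWithZero Γ']

/-- Domination of valuation rings suffices: if the image of $x$ is integral while $v(x)>1$, the
second condition applied to $x^{-1}$ gives a contradiction. -/
theorem hasExtension_of_le_one_of_lt_one {v : Valuation K Γ} {w : Valuation L Γ'}
    (h₁ : ∀ x, v x ≤ 1 → w (algebraMap K L x) ≤ 1) (h₂ : ∀ x, v x < 1 → w (algebraMap K L x) < 1) :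
    v.HasExtension w where
  val_isEquiv_comap := by
    rw [Valuation.isEquiv_iff_val_le_one]
    intro x
    refine ⟨h₁ x, fun h ↦ ?_⟩
    by_contra! hx
    have := h₂ x⁻¹ (by rw [map_inv₀]; exact inv_lt_one_of_one_lt₀ hx)
    rw [map_inv₀, map_inv₀] at this
    have h0 : w (algebraMap K L x) ≠ 0 := by
      have : x ≠ 0 := by
        rintro rfl
        simp at hx
      simpa using this
    exact absurd this (not_lt.2 ((one_le_inv₀ (zero_lt_iff.2 h0)).2 h))

/-- Chevalley's theorem: the image of the valuation ring of $v$ is dominated by a valuation ring of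
$L$. -/
theorem exists_hasExtension (v : Valuation K Γ) :
    ∃ A : ValuationSubring L, v.HasExtension A.valuation := by
  obtain ⟨B, h, hB⟩ := IsLocalRing.exists_factor_valuationRing
    ((algebraMap K L).comp v.valuationSubring.subtype)
  refine ⟨B, hasExtension_of_le_one_of_lt_one ?_ ?_⟩
  · intro x hx
    rw [ValuationSubring.valuation_le_one_iff]
    exact h ⟨x, hx⟩
  · intro x hx
    have hxB : algebraMap K L x ∈ B := h ⟨x, hx.le⟩
    have := (ValuationSubring.valuation_lt_one_iff B ⟨_, hxB⟩).1
    refine this ?_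
    have hm : (⟨x, hx.le⟩ : v.valuationSubring) ∈ maximalIdeal v.valuationSubring := by
      rwa [Valuation.mem_maximalIdeal_iff]
    rw [mem_maximalIdeal] at hm ⊢
    exact fun hu ↦ hm (hB.1 _ hu)

theorem hasExtension_trans {M : Type*} [Field M] [Algebra K M] [Algebra L M]
    [IsScalarTower K L M] {Γ'' : Type*} [LinearOrderedCommGroupWithZero Γ'']
    {v : Valuation K Γ} (w : Valuation L Γ') {w' : Valuation M Γ''}
    [h : v.HasExtension w] [h' : w.HasExtension w'] : v.HasExtension w' := by
  refine hasExtension_of_le_one_of_lt_one (fun x hx ↦ ?_) (fun x hx ↦ ?_)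
  · rw [IsScalarTower.algebraMap_apply K L M, Valuation.HasExtension.val_map_le_one_iff w w',
      Valuation.HasExtension.val_map_le_one_iff v w]
    exact hx
  · rw [IsScalarTower.algebraMap_apply K L M, Valuation.HasExtension.val_map_lt_one_iff w w',
      Valuation.HasExtension.val_map_lt_one_iff v w]
    exact hx

end Extend
end HenselRat

namespace HenselRat
open IsLocalRing

/-! ### Nests of balls and eventual values of polynomials -/

section Spherical

variable {L : Type*} [Field L] {Γ : Type*} [LinearOrderedCommGroupWithZero Γ]

/-- The balls with centers and radii in `S` are pairwise comparable. -/
def IsNest (w : Valuation L Γ) (S : Set (L × Γ)) : Prop :=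
  ∀ a ∈ S, ∀ b ∈ S, w (a.1 - b.1) ≤ max a.2 b.2

/-- Every nest of balls with centers in `U` has a common point in `U`. -/
def SphericallyCompleteOn (w : Valuation L Γ) (U : Set L) : Prop :=
  ∀ S : Set (L × Γ), (∀ a ∈ S, a.1 ∈ U) → IsNest w S → ∃ x ∈ U, ∀ a ∈ S, w (x - a.1) ≤ a.2

/-- The filter generated by a set of balls. -/
def ballFilter (w : Valuation L Γ) (S : Set (L × Γ)) : Filter L :=
  ⨅ a ∈ S, Filter.principal {c | w (c - a.1) ≤ a.2}

variable {w : Valuation L Γ} {S : Set (L × Γ)}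

theorem IsNest.ball_subset (hS : IsNest w S) {a b : L × Γ} (ha : a ∈ S) (hb : b ∈ S)
    (hab : a.2 ≤ b.2) : {c | w (c - a.1) ≤ a.2} ⊆ {c | w (c - b.1) ≤ b.2} := by
  intro c (hc : w (c - a.1) ≤ a.2)
  have : c - b.1 = (c - a.1) + (a.1 - b.1) := by ring
  show w (c - b.1) ≤ b.2
  rw [this]
  exact Valuation.map_add_le _ (hc.trans hab) ((hS a ha b hb).trans (max_le hab le_rfl))

theorem IsNest.hasBasis (hS : IsNest w S) (hne : S.Nonempty) :
    (ballFilter w S).HasBasis (· ∈ S) (fun a ↦ {c | w (c - a.1) ≤ a.2}) := by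
  refine Filter.hasBasis_biInf_principal' (fun a ha b hb ↦ ?_) hne
  rcases le_total a.2 b.2 with h | h
  · exact ⟨a, ha, subset_rfl, hS.ball_subset ha hb h⟩
  · exact ⟨b, hb, hS.ball_subset hb ha h, subset_rfl⟩

theorem IsNest.neBot (hS : IsNest w S) (hne : S.Nonempty) : (ballFilter w S).NeBot := by
  rw [(hS.hasBasis hne).neBot_iff]
  intro a _
  exact ⟨a.1, by simp⟩

/-- The value of the polynomial `f` is eventually constant along the filter `F`. -/
def EventuallyConst (w : Valuation L Γ) (F : Filter L) (f : Polynomial L) : Prop :=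
  ∃ γ, ∀ᶠ c in F, w (f.eval c) = γ

open Classical in
/-- The eventual value of the polynomial `f` along the filter `F`. -/
noncomputable def eventualVal (w : Valuation L Γ) (F : Filter L) (f : Polynomial L) : Γ :=
  if h : EventuallyConst w F f then h.choose else 0

theorem EventuallyConst.eventually {F : Filter L} {f : Polynomial L}
    (h : EventuallyConst w F f) : ∀ᶠ c in F, w (f.eval c) = eventualVal w F f := by
  rw [eventualVal, dif_pos h]
  exact h.choose_spec

theorem eventualVal_eq {F : Filter L} [F.NeBot] {f : Polynomial L} {γ : Γ}
    (h : ∀ᶠ c in F, w (f.eval c) = γ) : eventualVal w F f = γ := by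
  obtain ⟨c, h₁, h₂⟩ := (h.and (EventuallyConst.eventually ⟨γ, h⟩)).exists
  exact h₂.symm.trans h₁

theorem eventualVal_C {F : Filter L} [F.NeBot] (c : L) :
    eventualVal w F (Polynomial.C c) = w c :=
  eventualVal_eq (by simp)

theorem eventualVal_mul {F : Filter L} [F.NeBot] {f g : Polynomial L}
    (hf : EventuallyConst w F f) (hg : EventuallyConst w F g) :
    EventuallyConst w F (f * g) ∧ eventualVal w F (f * g) = eventualVal w F f * eventualVal w F g := by
  have : ∀ᶠ c in F, w ((f * g).eval c) = eventualVal w F f * eventualVal w F g := by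
    filter_upwards [hf.eventually, hg.eventually] with c h₁ h₂
    rw [Polynomial.eval_mul, map_mul, h₁, h₂]
  exact ⟨⟨_, this⟩, eventualVal_eq this⟩

theorem eventualVal_add_le {F : Filter L} [F.NeBot] {f g : Polynomial L}
    (hf : EventuallyConst w F f) (hg : EventuallyConst w F g) (hfg : EventuallyConst w F (f + g)) :
    eventualVal w F (f + g) ≤ max (eventualVal w F f) (eventualVal w F g) := by
  obtain ⟨c, h₁, h₂, h₃⟩ := (hf.eventually.and (hg.eventually.and hfg.eventually)).exists
  rw [← h₁, ← h₂, ← h₃, Polynomial.eval_add]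
  exact w.map_add _ _

/-- Some ball of the nest misses $x$, and by the ultrametric inequality all its points have the same
distance from $x$. -/
theorem exists_eventually_val_sub (hS : IsNest w S) (hne : S.Nonempty)
    (hno : ∀ x, ∃ a ∈ S, a.2 < w (x - a.1)) (x : L) :
    ∃ δ, δ ≠ 0 ∧ ∀ᶠ c in ballFilter w S, w (c - x) = δ := by
  obtain ⟨a, ha, hax⟩ := hno x
  refine ⟨w (x - a.1), (zero_le.trans_lt hax).ne', ?_⟩
  rw [(hS.hasBasis hne).eventually_iff]
  refine ⟨a, ha, fun c hc ↦ ?_⟩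
  have : c - x = (c - a.1) - (x - a.1) := by ring
  rw [this, Valuation.map_sub_eq_of_lt_right _ (lt_of_le_of_lt hc hax)]

theorem eventually_eval_ne_zero (hS : IsNest w S) (hne : S.Nonempty)
    (hno : ∀ x, ∃ a ∈ S, a.2 < w (x - a.1)) {f : Polynomial L} (hf : f ≠ 0) :
    ∀ᶠ c in ballFilter w S, f.eval c ≠ 0 := by
  classical
  have : ∀ᶠ c in ballFilter w S, ∀ x ∈ f.roots.toFinset, c ≠ x := by
    rw [Filter.eventually_all_finset]
    intro x _
    obtain ⟨δ, h0, h⟩ := exists_eventually_val_sub hS hne hno x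
    filter_upwards [h] with c hc
    rintro rfl
    simp [← hc] at h0
  filter_upwards [this] with c hc h0
  exact hc c (by simpa [hf] using h0) rfl

theorem eventualVal_ne_zero (hS : IsNest w S) (hne : S.Nonempty)
    (hno : ∀ x, ∃ a ∈ S, a.2 < w (x - a.1)) {f : Polynomial L} (h : EventuallyConst w (ballFilter w S) f)
    (hf : f ≠ 0) : eventualVal w (ballFilter w S) f ≠ 0 := by
  have := hS.neBot hne
  obtain ⟨c, h₁, h₂⟩ := ((eventually_eval_ne_zero hS hne hno hf).and h.eventually).exists
  rw [← h₂]
  simpa using h₁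

theorem eventuallyConst_of_natDegree_le_one (hS : IsNest w S) (hne : S.Nonempty)
    (hno : ∀ x, ∃ a ∈ S, a.2 < w (x - a.1)) {f : Polynomial L} (h : f.natDegree ≤ 1) :
    EventuallyConst w (ballFilter w S) f := by
  obtain ⟨a, b, rfl⟩ := Polynomial.exists_eq_X_add_C_of_natDegree_le_one h
  by_cases ha : a = 0
  · subst ha
    exact ⟨w b, by simp⟩
  obtain ⟨δ, -, h⟩ := exists_eventually_val_sub hS hne hno (-b / a)
  refine ⟨w a * δ, ?_⟩
  filter_upwards [h] with c hc
  rw [← hc, ← map_mul]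
  congr 1
  simp only [Polynomial.eval_add, Polynomial.eval_mul, Polynomial.eval_C, Polynomial.eval_X]
  field_simp
  ring

/-- In a nest of balls without common point, the eventual distances from points of any of the
balls take infinitely many values. -/
theorem infinite_eventual_distances (hS : IsNest w S) (hne : S.Nonempty)
    (hno : ∀ x, ∃ a ∈ S, a.2 < w (x - a.1)) {s : Set L} (hs : s ∈ ballFilter w S) :
    {δ | δ ≠ 0 ∧ ∃ c ∈ s, ∀ᶠ c' in ballFilter w S, w (c' - c) = δ}.Infinite ∧
    ∀ δ, (∃ c ∈ s, ∀ᶠ c' in ballFilter w S, w (c' - c) = δ) →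
      ∃ δ' < δ, ∃ c ∈ s, ∀ᶠ c' in ballFilter w S, w (c' - c) = δ' := by
  have := hS.neBot hne
  -- The point $c$ lies outside some ball $a$. The centre of a ball of the nest inside $a$ is closer
  -- to the points of the filter than $c$ is.
  have key : ∀ δ, (∃ c ∈ s, ∀ᶠ c' in ballFilter w S, w (c' - c) = δ) →
      ∃ δ' < δ, ∃ c ∈ s, ∀ᶠ c' in ballFilter w S, w (c' - c) = δ' := by
    rintro δ ⟨c, -, hc⟩
    obtain ⟨a, ha, hac⟩ := hno c
    have h1 : {x | w (x - a.1) ≤ a.2} ∈ ballFilter w S := (hS.hasBasis hne).mem_of_mem ha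
    obtain ⟨b, hb, hbs⟩ := (hS.hasBasis hne).mem_iff.1 (Filter.inter_mem hs h1)
    have hb1 := hbs (show b.1 ∈ _ by simp)
    obtain ⟨δ', -, hδ'⟩ := exists_eventually_val_sub hS hne hno b.1
    refine ⟨δ', ?_, b.1, hb1.1, hδ'⟩
    obtain ⟨x, ⟨hx1, hx2⟩, hx3⟩ := ((hc.and hδ').and h1).exists
    have hx4 : w (x - a.1) ≤ a.2 := hx3
    have hb2 : w (b.1 - a.1) ≤ a.2 := hb1.2
    have e1 : δ = w (c - a.1) := by
      rw [← hx1, show x - c = (x - a.1) - (c - a.1) by ring, Valuation.map_sub_eq_of_lt_right _ (hx4.trans_lt hac)]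
    rw [e1, ← hx2, show x - b.1 = (x - a.1) - (b.1 - a.1) by ring]
    exact (Valuation.map_sub_le w hx4 hb2).trans_lt hac
  refine ⟨fun hfin ↦ ?_, key⟩
  obtain ⟨c, hc⟩ := Filter.nonempty_of_mem hs
  obtain ⟨δ, h0, hδ⟩ := exists_eventually_val_sub hS hne hno c
  obtain ⟨m, ⟨hm0, hm⟩, hmin⟩ := hfin.exists_minimal ⟨δ, h0, c, hc, hδ⟩
  obtain ⟨δ', hlt, c', hc', hδ'⟩ := key m hm
  obtain ⟨δ'', h0'', hδ''⟩ := exists_eventually_val_sub hS hne hno c'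
  obtain ⟨x, hx1, hx2⟩ := (hδ'.and hδ'').exists
  have : δ' ≠ 0 := by rwa [← hx1, hx2]
  exact absurd (hmin ⟨this, c', hc', hδ'⟩ hlt.le) (not_le.2 hlt)

/-- If the nonzero terms of a sum have pairwise distinct values, then no term has larger value than
the sum. -/
theorem val_le_val_sum_of_pairwise_ne {ι : Type*} {s : Finset ι} {f : ι → L}
    (h : ∀ i ∈ s, ∀ j ∈ s, i ≠ j → w (f i) ≠ 0 → w (f i) ≠ w (f j)) {i : ι} (hi : i ∈ s) :
    w (f i) ≤ w (∑ j ∈ s, f j) := by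
  classical
  obtain ⟨m, hm, hmax⟩ := s.exists_max_image (fun j ↦ w (f j)) ⟨i, hi⟩
  by_cases h0 : w (f m) = 0
  · exact (hmax i hi).trans (h0 ▸ zero_le)
  refine (hmax i hi).trans (le_of_eq ?_)
  symm
  refine Valuation.map_sum_eq_of_lt w hm fun j hj ↦ ?_
  rw [Finset.mem_sdiff, Finset.mem_singleton] at hj
  exact lt_of_le_of_ne (hmax j hj.1) (h m hm j hj.1 (Ne.symm hj.2) h0).symm

theorem eval_sub_eval_eq_sum (g : Polynomial L) (c x : L) :
    g.eval x - g.eval c = ∑ k ∈ Finset.range g.natDegree,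
      (Polynomial.hasseDeriv (k + 1) g).eval c * (x - c) ^ (k + 1) := by
  have : g.eval x = (Polynomial.taylor c g).eval (x - c) := by
    rw [Polynomial.taylor_eval, sub_add_cancel]
  rw [this, Polynomial.eval_eq_sum_range, Polynomial.natDegree_taylor, Finset.sum_range_succ']
  simp [Polynomial.taylor_coeff]

/-- This is what makes Kaplansky's extensions immediate. Expand $g(x)-g(c)$ in powers of $x-c$. For
a suitable eventual distance $\delta$ the nonzero Taylor terms have distinct values, so none exceeds
the value $\gamma$ of $g$. At a closer centre $c'$ every term drops strictly below $\gamma$, so the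
constant $g(c')$ approximates $g$. -/
theorem exists_eventualVal_sub_C_lt (hS : IsNest w S) (hne : S.Nonempty)
    (hno : ∀ x, ∃ a ∈ S, a.2 < w (x - a.1)) {g : Polynomial L} (hg : g ≠ 0)
    (hc : ∀ f : Polynomial L, f.natDegree ≤ g.natDegree → EventuallyConst w (ballFilter w S) f) :
    ∃ c : L, eventualVal w (ballFilter w S) (g - Polynomial.C c) <
      eventualVal w (ballFilter w S) g := by
  have := hS.neBot hne
  set F := ballFilter w S with hF
  set γ := eventualVal w F g with hγ
  have hγ0 : γ ≠ 0 := eventualVal_ne_zero hS hne hno (hc g le_rfl) hg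
  let β : ℕ → Γ := fun k ↦ eventualVal w F (Polynomial.hasseDeriv (k + 1) g)
  let d := g.natDegree
  -- Points at which $g$ and its Hasse derivatives already take their eventual values.
  let s : Set L := {c | w (g.eval c) = γ ∧
    ∀ k ∈ Finset.range d, w ((Polynomial.hasseDeriv (k + 1) g).eval c) = β k}
  have hs : s ∈ F := by
    have h2 : ∀ᶠ c in F, ∀ k ∈ Finset.range d,
        w ((Polynomial.hasseDeriv (k + 1) g).eval c) = β k := by
      rw [Filter.eventually_all_finset]
      intro k _
      exact (hc _ ((Polynomial.natDegree_hasseDeriv_le g (k + 1)).trans (Nat.sub_le _ _))).eventually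
    exact (hc g le_rfl).eventually.and h2
  obtain ⟨hinf, hdec⟩ := infinite_eventual_distances hS hne hno hs
  -- Distances at which two Taylor terms tie. Each pair of exponents rules out at most one $\delta$,
  -- whereas infinitely many distances occur.
  let bad : Set Γ := ⋃ p ∈ (Finset.range d ×ˢ Finset.range d : Finset (ℕ × ℕ)),
    {δ | δ ≠ 0 ∧ p.1 < p.2 ∧ β p.1 ≠ 0 ∧ β p.1 * δ ^ (p.1 + 1) = β p.2 * δ ^ (p.2 + 1)}
  have hbad : bad.Finite := by
    refine Set.Finite.biUnion (Finset.finite_toSet _) fun p _ ↦ Set.Subsingleton.finite ?_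
    have aux : ∀ δ : Γ, δ ≠ 0 → p.1 < p.2 → β p.1 ≠ 0 →
        β p.1 * δ ^ (p.1 + 1) = β p.2 * δ ^ (p.2 + 1) → β p.1 = β p.2 * δ ^ (p.2 - p.1) := by
      intro δ h0 hlt hb h
      have h3 : p.2 + 1 = (p.2 - p.1) + (p.1 + 1) := by omega
      rw [h3, pow_add δ (p.2 - p.1), ← mul_assoc] at h
      exact mul_right_cancel₀ (pow_ne_zero _ h0) h
    rintro δ ⟨h0, hlt, hb, h⟩ δ' ⟨h0', -, -, h'⟩
    have e1 := aux δ h0 hlt hb h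
    have e2 := aux δ' h0' hlt hb h'
    have hb2 : β p.2 ≠ 0 := by
      intro hz
      rw [hz, zero_mul] at e1
      exact hb e1
    have := mul_left_cancel₀ hb2 (e1.symm.trans e2)
    exact (pow_left_inj₀ zero_le zero_le (by omega)).1 this
  obtain ⟨δ, ⟨hδ0, c, hcs, hδ⟩, hδbad⟩ := (hinf.sdiff hbad).nonempty
  have hmax : ∀ k ∈ Finset.range d, β k * δ ^ (k + 1) ≤ γ := by
    obtain ⟨x, hx, hxs⟩ := (hδ.and hs).exists
    have hval : ∀ k ∈ Finset.range d,
        w ((Polynomial.hasseDeriv (k + 1) g).eval c * (x - c) ^ (k + 1)) = β k * δ ^ (k + 1) := by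
      intro k hk
      rw [map_mul, map_pow, hx, hcs.2 k hk]
    intro k hk
    rw [← hval k hk]
    have hnb : ∀ i ∈ Finset.range d, ∀ j ∈ Finset.range d, i < j → β i ≠ 0 →
        β i * δ ^ (i + 1) ≠ β j * δ ^ (j + 1) := by
      intro i hi j hj hij hb h
      refine hδbad ?_
      simp only [bad, Set.mem_iUnion]
      exact ⟨(i, j), Finset.mem_product.2 ⟨hi, hj⟩, hδ0, hij, hb, h⟩
    refine (val_le_val_sum_of_pairwise_ne (w := w) (f := fun k ↦
      (Polynomial.hasseDeriv (k + 1) g).eval c * (x - c) ^ (k + 1)) ?_ hk).trans ?_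
    · intro i hi j hj hij h0
      rw [hval i hi] at h0
      rw [hval i hi, hval j hj]
      have hbi : β i ≠ 0 := left_ne_zero_of_mul h0
      rcases lt_or_gt_of_ne hij with h | h
      · exact hnb i hi j hj h hbi
      · intro heq
        have hbj : β j ≠ 0 := by
          rw [heq] at h0
          exact left_ne_zero_of_mul h0
        exact hnb j hj i hi h hbj heq.symm
    · rw [← eval_sub_eval_eq_sum]
      exact Valuation.map_sub_le w hxs.1.le hcs.1.le
  obtain ⟨δ', hlt, c', hcs', hδ'⟩ := hdec δ ⟨c, hcs, hδ⟩
  refine ⟨g.eval c', ?_⟩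
  have hconst := hc (g - Polynomial.C (g.eval c')) (by simp)
  obtain ⟨x, hx, hxv⟩ := (hδ'.and hconst.eventually).exists
  rw [← hxv, Polynomial.eval_sub, Polynomial.eval_C, eval_sub_eval_eq_sum]
  refine Valuation.map_sum_lt w hγ0 fun k hk ↦ ?_
  rw [map_mul, map_pow, hx, hcs'.2 k hk]
  by_cases hb : β k = 0
  · rw [hb, zero_mul]
    exact zero_lt_iff.2 hγ0
  · refine lt_of_lt_of_le ?_ (hmax k hk)
    exact mul_lt_mul_of_pos_left (pow_lt_pow_left₀ hlt zero_le (by omega)) (zero_lt_iff.2 hb)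

end Spherical
end HenselRat

namespace HenselRat
open IsLocalRing

/-! ### Immediate extensions defined by nests of balls -/

section Kaplansky

variable {L : Type u} [Field L] {Γ : Type*} [LinearOrderedCommGroupWithZero Γ]
  {w : Valuation L Γ} {S : Set (L × Γ)}

/-- A nest of balls without common point along which some polynomial has no eventual value gives
rise to a proper immediate extension generated by a root of such a polynomial. -/
theorem exists_immediate_adjoinRoot (hS : IsNest w S) (hne : S.Nonempty)
    (hno : ∀ x, ∃ a ∈ S, a.2 < w (x - a.1)) {q : Polynomial L} (hq : q.Monic)
    (hqc : ¬ EventuallyConst w (ballFilter w S) q)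
    (hmin : ∀ f : Polynomial L, f.natDegree < q.natDegree →
      EventuallyConst w (ballFilter w S) f) :
    ∃ _ : Fact (Irreducible q), ∃ w' : Valuation (AdjoinRoot q) Γ,
      w'.comap (algebraMap L (AdjoinRoot q)) = w ∧ ApproxBy L w' ∧
      ¬ Function.Surjective (algebraMap L (AdjoinRoot q)) := by
  have := hS.neBot hne
  set F := ballFilter w S with hF
  have hdeg : 1 < q.natDegree := by
    by_contra! h
    exact hqc (eventuallyConst_of_natDegree_le_one hS hne hno h)
  have hq1 : q ≠ 1 := by
    rintro rfl
    simp at hdeg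
  have hirr : Irreducible q := by
    rw [hq.irreducible_iff_natDegree]
    refine ⟨hq1, fun f g _ _ hfg ↦ ?_⟩
    by_contra! h
    have hd := congrArg Polynomial.natDegree hfg
    rw [Polynomial.natDegree_mul (by rintro rfl; simp at h) (by rintro rfl; simp at h)] at hd
    exact hqc (hfg ▸ (eventualVal_mul (hmin f (by omega)) (hmin g (by omega))).1)
  have : Fact (Irreducible q) := ⟨hirr⟩
  -- The value of a class is the eventual value of its remainder modulo $q$, which exists because
  -- the degree is below that of $q$.
  let r := AdjoinRoot.modByMonicHom hq
  have hmk : ∀ x, AdjoinRoot.mk q (r x) = x := AdjoinRoot.mk_leftInverse hq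
  have hrdeg : ∀ x, (r x).natDegree < q.natDegree := by
    intro x
    obtain ⟨f, rfl⟩ := AdjoinRoot.mk_surjective x
    rw [show r (AdjoinRoot.mk q f) = f %ₘ q from AdjoinRoot.modByMonicHom_mk hq f]
    exact Polynomial.natDegree_modByMonic_lt f hq hq1
  have hrc : ∀ x, EventuallyConst w F (r x) := fun x ↦ hmin _ (hrdeg x)
  have hralg : ∀ c, r (algebraMap L (AdjoinRoot q) c) = Polynomial.C c := by
    intro c
    have : algebraMap L (AdjoinRoot q) c = AdjoinRoot.mk q (Polynomial.C c) := rfl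
    rw [this, show r _ = _ from AdjoinRoot.modByMonicHom_mk hq _,
      Polynomial.modByMonic_eq_self_iff hq]
    exact Polynomial.degree_lt_degree (by simpa using by omega)
  have hmul : ∀ x y, eventualVal w F (r (x * y)) = eventualVal w F (r x) * eventualVal w F (r y) := by
    intro x y
    obtain ⟨hc, he⟩ := eventualVal_mul (hrc x) (hrc y)
    rw [← he]
    set k := (r x * r y) /ₘ q with hk
    have hkdeg : k.natDegree < q.natDegree := by
      rw [hk, Polynomial.natDegree_divByMonic _ hq]
      have := Polynomial.natDegree_mul_le (p := r x) (q := r y)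
      have := hrdeg x
      have := hrdeg y
      omega
    have hrem : r (x * y) = (r x * r y) %ₘ q := by
      conv_lhs => rw [← hmk x, ← hmk y, ← map_mul]
      exact AdjoinRoot.modByMonicHom_mk hq _
    have hsum : r x * r y = r (x * y) + q * k := by
      rw [hrem, hk, Polynomial.modByMonic_add_div]
    by_contra hne'
    have hk0 : k ≠ 0 := by
      intro h0
      rw [h0, mul_zero, add_zero] at hsum
      exact hne' (by rw [hsum])
    -- If the product and its remainder had different eventual values, $qk$ would eventually have
    -- the larger one. Dividing by the value of $k$ would give $q$ an eventual value.
    refine hqc ⟨max (eventualVal w F (r x * r y)) (eventualVal w F (r (x * y))) /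
      eventualVal w F k, ?_⟩
    filter_upwards [hc.eventually, (hrc (x * y)).eventually, (hmin k hkdeg).eventually]
      with c h1 h2 h3
    rw [eq_div_iff (eventualVal_ne_zero hS hne hno (hmin k hkdeg) hk0), ← h1, ← h2, ← h3, ← map_mul,
      ← Polynomial.eval_mul]
    have : q * k = r x * r y - r (x * y) := by rw [hsum]; ring
    rw [this, Polynomial.eval_sub, sub_eq_add_neg, Valuation.map_add_of_distinct_val,
      Valuation.map_neg]
    rw [Valuation.map_neg, h1, h2]
    exact Ne.symm hne'
  let w' : Valuation (AdjoinRoot q) Γ :=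
    { toFun := fun x ↦ eventualVal w F (r x)
      map_zero' := by
        rw [map_zero]
        exact eventualVal_eq (by simp)
      map_one' := by
        have := hralg 1
        rw [map_one] at this
        rw [this, eventualVal_C, map_one]
      map_mul' := hmul
      map_add_le_max' := fun x y ↦ by
        rw [map_add]
        exact eventualVal_add_le (hrc x) (hrc y) (map_add r x y ▸ hrc (x + y)) }
  have hw' : ∀ x, w' x = eventualVal w F (r x) := fun _ ↦ rfl
  refine ⟨inferInstance, w', ?_, ?_, ?_⟩
  · ext c
    rw [Valuation.comap_apply, hw', hralg, eventualVal_C]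
  · intro x hx
    have hr0 : r x ≠ 0 := by
      intro h
      exact hx (by rw [← hmk x, h, map_zero])
    obtain ⟨c, hc⟩ := exists_eventualVal_sub_C_lt hS hne hno hr0
      (fun f hf ↦ hmin f (hf.trans_lt (hrdeg x)))
    refine ⟨c, ?_⟩
    rwa [hw', hw', map_sub, hralg]
  · intro hsurj
    obtain ⟨c, hc⟩ := hsurj (AdjoinRoot.root q)
    have h1 : AdjoinRoot.mk q (Polynomial.X - Polynomial.C c) = 0 := by
      rw [map_sub, AdjoinRoot.mk_X, AdjoinRoot.mk_C, ← hc, sub_eq_zero]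
      rfl
    rw [AdjoinRoot.mk_eq_zero] at h1
    have := Polynomial.natDegree_le_of_dvd h1 (Polynomial.X_sub_C_ne_zero c)
    rw [Polynomial.natDegree_X_sub_C] at this
    omega

/-- Approximating numerator and denominator suffices, by $a/b-c/d=((a-c)d-c(b-d))/(bd)$. -/
theorem approxBy_of_forall_exists_div {M : Type*} [Field M] [Algebra L M] {w' : Valuation M Γ}
    {A : Set M} (hA : ∀ x ∈ A, x ≠ 0 → ∃ c : L, w' (x - algebraMap L M c) < w' x)
    (hdiv : ∀ x, ∃ a ∈ A, ∃ b ∈ A, x = a / b) : ApproxBy L w' := by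
  intro x hx
  obtain ⟨a, ha, b, hb, rfl⟩ := hdiv x
  obtain ⟨ha0, hb0⟩ := div_ne_zero_iff.1 hx
  obtain ⟨c, hc⟩ := hA a ha ha0
  obtain ⟨d, hd⟩ := hA b hb hb0
  refine ⟨c / d, ?_⟩
  set c' := algebraMap L M c
  set d' := algebraMap L M d with hd'
  have hcv := val_eq_of_sub_lt hc
  have hdv := val_eq_of_sub_lt hd
  have hwb : w' b ≠ 0 := by simpa using hb0
  have hd0 : d' ≠ 0 := by
    rw [← w'.ne_zero_iff, hdv]
    exact hwb
  have : a / b - algebraMap L M (c / d) = ((a - c') * d' - c' * (b - d')) / (b * d') := by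
    rw [map_div₀, show algebraMap L M c = c' from rfl, ← hd']
    field_simp
    ring
  rw [this, map_div₀, map_div₀, map_mul, hdv,
    div_lt_iff₀ (mul_pos (zero_lt_iff.2 hwb) (zero_lt_iff.2 hwb)), div_mul_eq_mul_div,
    mul_div_assoc, mul_div_assoc, div_self hwb, mul_one]
  refine (w'.map_sub _ _).trans_lt (max_lt ?_ ?_)
  · rw [map_mul, hdv]
    exact mul_lt_mul_of_pos_right hc (zero_lt_iff.2 hwb)
  · rw [map_mul, hcv]
    exact mul_lt_mul_of_pos_left hd (zero_lt_iff.2 (by simpa using ha0))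

/-- A nest of balls without common point along which all polynomials have an eventual value gives
rise to an immediate extension to the field of rational functions. -/
theorem exists_immediate_ratFunc (hS : IsNest w S) (hne : S.Nonempty)
    (hno : ∀ x, ∃ a ∈ S, a.2 < w (x - a.1))
    (hall : ∀ f : Polynomial L, EventuallyConst w (ballFilter w S) f) :
    ∃ w' : Valuation (RatFunc L) Γ, w'.comap (algebraMap L (RatFunc L)) = w ∧ ApproxBy L w' := by
  have := hS.neBot hne
  set F := ballFilter w S with hF
  let w₀ : Valuation (Polynomial L) Γ :=
    { toFun := fun f ↦ eventualVal w F f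
      map_zero' := eventualVal_eq (by simp)
      map_one' := eventualVal_eq (by simp)
      map_mul' := fun f g ↦ (eventualVal_mul (hall f) (hall g)).2
      map_add_le_max' := fun f g ↦ eventualVal_add_le (hall f) (hall g) (hall _) }
  have hsupp : nonZeroDivisors (Polynomial L) ≤ w₀.supp.primeCompl := by
    intro f hf hf0
    exact eventualVal_ne_zero hS hne hno (hall f) (nonZeroDivisors.ne_zero hf) hf0
  let w' : Valuation (RatFunc L) Γ := w₀.extendToLocalization hsupp (RatFunc L)
  have hw' : ∀ f, w' (algebraMap (Polynomial L) (RatFunc L) f) = eventualVal w F f :=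
    fun f ↦ Valuation.extendToLocalization_apply_map_apply _ _ _ f
  have halg : ∀ c : L, algebraMap L (RatFunc L) c =
      algebraMap (Polynomial L) (RatFunc L) (Polynomial.C c) := fun c ↦ by
    simp
  refine ⟨w', ?_, approxBy_of_forall_exists_div
    (A := Set.range (algebraMap (Polynomial L) (RatFunc L))) ?_ ?_⟩
  · ext c
    rw [Valuation.comap_apply, halg, hw', eventualVal_C]
  · rintro _ ⟨f, rfl⟩ hf
    have hf0 : f ≠ 0 := by
      rintro rfl
      simp at hf
    obtain ⟨c, hc⟩ := exists_eventualVal_sub_C_lt hS hne hno hf0 (fun f _ ↦ hall f)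
    exact ⟨c, by rwa [halg, ← map_sub, hw', hw']⟩
  · intro x
    exact ⟨_, ⟨x.num, rfl⟩, _, ⟨x.denom, rfl⟩, (RatFunc.num_div_denom x).symm⟩

/-- A valued field that is not spherically complete has a proper immediate extension which embeds
into every algebraically closed extension field of positive transcendence degree. -/
theorem exists_immediate_of_not_sphericallyCompleteOn
    (h : ¬ SphericallyCompleteOn w (Set.univ : Set L)) :
    ∃ (M : Type u) (_ : Field M) (_ : Algebra L M) (w' : Valuation M Γ),
      w'.comap (algebraMap L M) = w ∧ ApproxBy L w' ∧ ¬ Function.Surjective (algebraMap L M) ∧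
      ∀ (Ω : Type u) [Field Ω] [Algebra L Ω] [IsAlgClosed Ω], Algebra.Transcendental L Ω →
        Nonempty (M →ₐ[L] Ω) := by
  simp only [SphericallyCompleteOn, Set.mem_univ, true_and] at h
  push Not at h
  obtain ⟨S, -, hS, hno⟩ := h
  have hne : S.Nonempty := by
    obtain ⟨a, ha, -⟩ := hno 0
    exact ⟨a, ha⟩
  by_cases hall : ∀ f : Polynomial L, EventuallyConst w (ballFilter w S) f
  · obtain ⟨w', hw', happ⟩ := exists_immediate_ratFunc hS hne hno hall
    refine ⟨RatFunc L, inferInstance, inferInstance, w', hw', happ, ?_, ?_⟩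
    · intro hs
      obtain ⟨c, hc⟩ := hs RatFunc.X
      have hc' : algebraMap (Polynomial L) (RatFunc L) (Polynomial.C c) =
          algebraMap (Polynomial L) (RatFunc L) Polynomial.X := by
        simpa using hc
      have := IsFractionRing.injective (Polynomial L) (RatFunc L) hc'
      exact Polynomial.X_ne_C c this.symm
    · intro Ω _ _ _ htr
      obtain ⟨t, ht⟩ := htr.transcendental
      refine ⟨RatFunc.liftAlgHom (Polynomial.aeval t) ?_⟩
      intro f hf
      rw [Submonoid.mem_comap]
      refine mem_nonZeroDivisors_of_ne_zero fun h0 ↦ nonZeroDivisors.ne_zero hf ?_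
      exact (transcendental_iff.1 ht) f h0
  · push Not at hall
    classical
    have hex : ∃ n, ∃ f : Polynomial L, f.natDegree = n ∧
        ¬ EventuallyConst w (ballFilter w S) f := by
      obtain ⟨f, hf⟩ := hall
      exact ⟨_, f, rfl, hf⟩
    -- A polynomial of least degree without eventual value, to be made monic.
    obtain ⟨f, hfn, hf⟩ := Nat.find_spec hex
    have hmin : ∀ g : Polynomial L, g.natDegree < f.natDegree →
        EventuallyConst w (ballFilter w S) g := by
      intro g hg
      by_contra hcon
      exact Nat.find_min hex (hfn ▸ hg) ⟨g, rfl, hcon⟩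
    have hf0 : f ≠ 0 := by
      rintro rfl
      exact hf ⟨0, by simp⟩
    have hlc : f.leadingCoeff⁻¹ ≠ 0 := inv_ne_zero (Polynomial.leadingCoeff_ne_zero.2 hf0)
    set q := f * Polynomial.C f.leadingCoeff⁻¹ with hqdef
    have hq : q.Monic := Polynomial.monic_mul_leadingCoeff_inv hf0
    have hqdeg : q.natDegree = f.natDegree := Polynomial.natDegree_mul_C hlc
    have hqc : ¬ EventuallyConst w (ballFilter w S) q := by
      rintro ⟨γ, hγ⟩
      refine hf ⟨γ / w f.leadingCoeff⁻¹, ?_⟩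
      filter_upwards [hγ] with c hc
      rw [eq_div_iff (by simpa using hf0), ← hc, ← map_mul, hqdef, Polynomial.eval_mul,
        Polynomial.eval_C]
    obtain ⟨_, w', hw', happ, hns⟩ := exists_immediate_adjoinRoot hS hne hno hq hqc
      (fun g hg ↦ hmin g (hqdeg ▸ hg))
    refine ⟨AdjoinRoot q, inferInstance, inferInstance, w', hw', happ, hns, ?_⟩
    intro Ω _ _ _ _
    have hqd : q.degree ≠ 0 := by
      have : 1 < q.natDegree := by
        by_contra! h
        exact hqc (eventuallyConst_of_natDegree_le_one hS hne hno h)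
      intro h0
      rw [Polynomial.natDegree_eq_zero_iff_degree_le_zero.2 h0.le] at this
      omega
    obtain ⟨t, ht⟩ := IsAlgClosed.exists_aeval_eq_zero Ω q hqd
    exact ⟨AdjoinRoot.liftAlgHom q (Algebra.ofId L Ω) t ht⟩

end Kaplansky
end HenselRat

namespace HenselRat
open IsLocalRing

/-! ### Maximal immediate extensions inside a given field -/

section Zorn

variable {F Ω : Type*} [Field F] [Field Ω] [Algebra F Ω]
  {Γ : Type*} [LinearOrderedCommGroupWithZero Γ]

/-- The subring `R` is a valuation ring of the intermediate field `E`, which thereby becomes an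
immediate extension of `(F, v)`. -/
structure IsImmediateSubpair (v : Valuation F Γ) (E : IntermediateField F Ω) (R : Subring Ω) :
    Prop where
  le : ∀ x ∈ R, x ∈ E
  mem_or_inv_mem : ∀ x ∈ E, x ∈ R ∨ x⁻¹ ∈ R
  algebraMap_mem_iff : ∀ c : F, algebraMap F Ω c ∈ R ↔ v c ≤ 1
  -- The second alternative says that the relative error $(x-c)/x$ has value below $1$. Exact
  -- equality needs its own alternative, since the inverse of $0$ is $0$ and lies in $R$.
  approx : ∀ x ∈ E, x ≠ 0 → ∃ c : F, x = algebraMap F Ω c ∨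
    ((x - algebraMap F Ω c) / x)⁻¹ ∉ R

/-- Moves an abstract immediate extension into $\Omega$, where it can be compared with a maximal
pair. -/
theorem IsImmediateSubpair.of_algHom {v : Valuation F Γ} {M : Type*} [Field M] [Algebra F M]
    {Δ : Type*} [LinearOrderedCommGroupWithZero Δ] (w : Valuation M Δ) [v.HasExtension w]
    (h : ApproxBy F w) (σ : M →ₐ[F] Ω) :
    IsImmediateSubpair v σ.fieldRange (w.integer.map (σ : M →+* Ω)) where
  le := by
    rintro _ ⟨y, -, rfl⟩
    exact ⟨y, rfl⟩
  mem_or_inv_mem := by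
    rintro _ ⟨y, rfl⟩
    rcases w.valuationSubring.mem_or_inv_mem y with hy | hy
    · exact Or.inl ⟨y, hy, rfl⟩
    · exact Or.inr ⟨y⁻¹, hy, map_inv₀ σ y⟩
  algebraMap_mem_iff := by
    intro c
    rw [← Valuation.HasExtension.val_map_le_one_iff v w]
    constructor
    · rintro ⟨y, hy, hyc⟩
      have : y = algebraMap F M c := σ.injective (hyc.trans (σ.commutes c).symm)
      rw [← this]
      exact hy
    · intro hc
      exact ⟨algebraMap F M c, hc, σ.commutes c⟩
  approx := by
    rintro _ ⟨y, rfl⟩ hy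
    have hy0 : y ≠ 0 := by
      rintro rfl
      simp at hy
    obtain ⟨c, hc⟩ := h y hy0
    refine ⟨c, or_iff_not_imp_left.2 fun hne ↦ ?_⟩
    rintro ⟨z, hz, hzy⟩
    have hyc : y - algebraMap F M c ≠ 0 := by
      intro h0
      apply hne
      rw [sub_eq_zero.1 h0]
      exact σ.commutes c
    have : z = ((y - algebraMap F M c) / y)⁻¹ := by
      apply σ.injective
      show σ z = σ _
      rw [map_inv₀, map_div₀, map_sub, AlgHom.commutes]
      exact hzy
    have hz1 : w z ≤ 1 := hz
    rw [this, map_inv₀, map_div₀, inv_div,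
      div_le_one₀ (zero_lt_iff.2 (w.ne_zero_iff.2 hyc))] at hz1
    exact absurd hc (not_lt.2 hz1)

/-- The valuation ring of an intermediate field given by a subring of the big field. -/
def IsImmediateSubpair.valuationSubring {v : Valuation F Γ} {E : IntermediateField F Ω}
    {R : Subring Ω} (h : IsImmediateSubpair v E R) : ValuationSubring E :=
  { R.comap (algebraMap E Ω) with
    mem_or_inv_mem' := fun x ↦ h.mem_or_inv_mem x x.2 }

theorem IsImmediateSubpair.mem_valuationSubring {v : Valuation F Γ} {E : IntermediateField F Ω}
    {R : Subring Ω} (h : IsImmediateSubpair v E R) {x : E} :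
    x ∈ h.valuationSubring ↔ (x : Ω) ∈ R := Iff.rfl

theorem IsImmediateSubpair.hasExtension {v : Valuation F Γ} {E : IntermediateField F Ω}
    {R : Subring Ω} (h : IsImmediateSubpair v E R) :
    v.HasExtension h.valuationSubring.valuation where
  val_isEquiv_comap := by
    rw [Valuation.isEquiv_iff_val_le_one]
    intro c
    rw [Valuation.comap_apply, ValuationSubring.valuation_le_one_iff, h.mem_valuationSubring,
      ← h.algebraMap_mem_iff]
    rfl

theorem IsImmediateSubpair.approxBy {v : Valuation F Γ} {E : IntermediateField F Ω}
    {R : Subring Ω} (h : IsImmediateSubpair v E R) :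
    ApproxBy F h.valuationSubring.valuation := by
  intro x hx
  obtain ⟨c, hc⟩ := h.approx x x.2 (by simpa using hx)
  refine ⟨c, ?_⟩
  have hvx : h.valuationSubring.valuation x ≠ 0 := by simpa using hx
  rcases hc with hc | hc
  · have : x - algebraMap F E c = 0 := by
      ext
      simpa [sub_eq_zero] using hc
    rw [this, map_zero]
    exact zero_lt_iff.2 hvx
  · by_contra! hle
    apply hc
    have hv0 : h.valuationSubring.valuation (x - algebraMap F E c) ≠ 0 := fun h0 ↦
      hvx (le_antisymm (h0 ▸ hle) zero_le)
    have : ((x - algebraMap F E c) / x)⁻¹ ∈ h.valuationSubring := by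
      rw [← ValuationSubring.valuation_le_one_iff, map_inv₀, map_div₀, inv_div,
        div_le_one₀ (zero_lt_iff.2 hv0)]
      exact hle
    exact this

/-- Zorn's Lemma, ordered by extension of valued fields: the larger ring must cut out exactly the
smaller one on the smaller field. The defining conditions concern finitely many elements at a time,
so unions of chains inherit them. -/
theorem exists_maximal_isImmediateSubpair (v : Valuation F Γ) :
    ∃ (E : IntermediateField F Ω) (R : Subring Ω), IsImmediateSubpair v E R ∧
      ∀ (E' : IntermediateField F Ω) (R' : Subring Ω), IsImmediateSubpair v E' R' →
        E ≤ E' → R ≤ R' → (∀ x ∈ R', x ∈ E → x ∈ R) → E' ≤ E := by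
  let T := {p : IntermediateField F Ω × Subring Ω // IsImmediateSubpair v p.1 p.2}
  let r : T → T → Prop := fun p q ↦ p.1.1 ≤ q.1.1 ∧ p.1.2 ≤ q.1.2 ∧ ∀ x ∈ q.1.2, x ∈ p.1.1 → x ∈ p.1.2
  have htrans : ∀ {a b c : T}, r a b → r b c → r a c := by
    rintro a b c ⟨h1, h2, h3⟩ ⟨h1', h2', h3'⟩
    exact ⟨h1.trans h1', h2.trans h2', fun x hx hxa ↦ h3 x (h3' x hx (h1 hxa)) hxa⟩
  have hrefl : ∀ a : T, r a a := fun a ↦ ⟨le_rfl, le_rfl, fun x hx _ ↦ hx⟩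
  have hbase : T := ⟨(_, _), IsImmediateSubpair.of_algHom v
    (fun x hx ↦ ⟨x, by simpa [zero_lt_iff] using hx⟩) (Algebra.ofId F Ω)⟩
  have hchain : ∀ c : Set T, IsChain r c → ∃ ub, ∀ a ∈ c, r a ub := by
    intro c hc
    rcases c.eq_empty_or_nonempty with rfl | hne
    · exact ⟨hbase, by simp⟩
    have : Nonempty c := hne.to_subtype
    have hdir : ∀ p q : c, ∃ t : c, r p t ∧ r q t := by
      intro p q
      rcases eq_or_ne p q with rfl | hpq
      · exact ⟨p, hrefl _, hrefl _⟩
      · rcases hc p.2 q.2 (fun h ↦ hpq (Subtype.ext h)) with h | h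
        · exact ⟨q, h, hrefl _⟩
        · exact ⟨p, hrefl _, h⟩
    have hdE : Directed (· ≤ ·) (fun p : c ↦ p.1.1.1) := fun p q ↦
      (hdir p q).imp fun t ht ↦ ⟨ht.1.1, ht.2.1⟩
    have hdR : Directed (· ≤ ·) (fun p : c ↦ p.1.1.2) := fun p q ↦
      (hdir p q).imp fun t ht ↦ ⟨ht.1.2.1, ht.2.2.1⟩
    let E := ⨆ p : c, p.1.1.1
    let R := ⨆ p : c, p.1.1.2
    have hE : ∀ x, x ∈ E ↔ ∃ p : c, x ∈ p.1.1.1 := fun x ↦ by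
      rw [← SetLike.mem_coe, IntermediateField.coe_iSup_of_directed hdE]
      simp
    have hR : ∀ x, x ∈ R ↔ ∃ p : c, x ∈ p.1.1.2 := fun x ↦ Subring.mem_iSup_of_directed hdR
    have hRp : ∀ (p : c) (x : Ω), x ∈ R → x ∈ p.1.1.1 → x ∈ p.1.1.2 := by
      intro p x hx hxp
      obtain ⟨q, hq⟩ := (hR x).1 hx
      obtain ⟨t, hpt, hqt⟩ := hdir p q
      exact hpt.2.2 x (hqt.2.1 hq) hxp
    refine ⟨⟨(E, R), ⟨?_, ?_, ?_, ?_⟩⟩, ?_⟩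
    · intro x hx
      obtain ⟨p, hp⟩ := (hR x).1 hx
      exact (hE x).2 ⟨p, p.1.2.le x hp⟩
    · intro x hx
      obtain ⟨p, hp⟩ := (hE x).1 hx
      exact (p.1.2.mem_or_inv_mem x hp).imp (fun h ↦ (hR _).2 ⟨p, h⟩) (fun h ↦ (hR _).2 ⟨p, h⟩)
    · intro d
      obtain ⟨p⟩ := this
      rw [← p.1.2.algebraMap_mem_iff]
      exact ⟨fun h ↦ hRp p _ h (algebraMap_mem _ d), fun h ↦ (hR _).2 ⟨p, h⟩⟩
    · intro x hx hx0
      obtain ⟨p, hp⟩ := (hE x).1 hx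
      obtain ⟨d, hd⟩ := p.1.2.approx x hp hx0
      refine ⟨d, hd.imp id fun h hcon ↦ h (hRp p _ hcon ?_)⟩
      exact inv_mem (div_mem (sub_mem hp (algebraMap_mem _ d)) hp)
    · intro p hp
      exact ⟨fun x hx ↦ (hE x).2 ⟨⟨p, hp⟩, hx⟩, fun x hx ↦ (hR x).2 ⟨⟨p, hp⟩, hx⟩, hRp ⟨p, hp⟩⟩
  obtain ⟨m, hm⟩ := exists_maximal_of_chains_bounded hchain htrans
  refine ⟨m.1.1, m.1.2, m.2, fun E' R' h' h1 h2 h3 ↦ ?_⟩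
  exact (hm ⟨(E', R'), h'⟩ ⟨h1, h2, h3⟩).1

/-- Among the immediate extensions of `(F, v)` inside `Ω` there is one which has no proper
immediate extension that embeds into `Ω`. -/
theorem exists_maximal_immediate_subextension (Ω : Type*) [Field Ω] [Algebra F Ω]
    (v : Valuation F Γ) :
    ∃ (E : IntermediateField F Ω) (A : ValuationSubring E), v.HasExtension A.valuation ∧
      ApproxBy F A.valuation ∧
      ∀ {M : Type*} [Field M] [Algebra F M] [Algebra E M] [IsScalarTower F E M]
        {Δ : Type*} [LinearOrderedCommGroupWithZero Δ] (w : Valuation M Δ),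
        A.valuation.HasExtension w → ApproxBy F w → (M →ₐ[E] Ω) →
        Function.Surjective (algebraMap E M) := by
  obtain ⟨E, R, h, hmax⟩ := exists_maximal_isImmediateSubpair (Ω := Ω) v
  refine ⟨E, h.valuationSubring, h.hasExtension, h.approxBy, ?_⟩
  intro M _ _ _ _ Δ _ w hw happ σ
  have hv := h.hasExtension
  have : v.HasExtension w := hasExtension_trans h.valuationSubring.valuation
  have hpair := IsImmediateSubpair.of_algHom (v := v) w happ (σ.restrictScalars F)
  have hle := hmax _ _ hpair ?_ ?_ ?_
  · intro y
    have hy : σ y ∈ E := hle ⟨y, rfl⟩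
    refine ⟨⟨σ y, hy⟩, σ.injective ?_⟩
    exact σ.commutes _
  · intro x hx
    exact ⟨algebraMap E M ⟨x, hx⟩, σ.commutes ⟨x, hx⟩⟩
  · intro x hx
    refine ⟨algebraMap E M ⟨x, h.le x hx⟩, ?_, σ.commutes ⟨x, h.le x hx⟩⟩
    show w _ ≤ 1
    rw [Valuation.HasExtension.val_map_le_one_iff h.valuationSubring.valuation w,
      ValuationSubring.valuation_le_one_iff]
    exact hx
  · rintro x ⟨y, hy, hyx⟩ hx
    have : y = algebraMap E M ⟨x, hx⟩ := σ.injective (hyx.trans (σ.commutes ⟨x, hx⟩).symm)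
    have hy' : w y ≤ 1 := hy
    rw [this, Valuation.HasExtension.val_map_le_one_iff h.valuationSubring.valuation w,
      ValuationSubring.valuation_le_one_iff] at hy'
    exact hy'

end Zorn

/-! ### A cardinality bound and spherically complete immediate extensions -/

section Cardinality

variable {N L : Type u} [Field N] [Field L] [Algebra N L]
  {Γ : Type*} [LinearOrderedCommGroupWithZero Γ]

/-- The cardinality of an immediate extension is bounded in terms of the ground field. -/
theorem ApproxBy.cardinalMk_le {w : Valuation L Γ} (h : ApproxBy N w) :
    Cardinal.mk L ≤ Cardinal.mk (N → N) := by
  classical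
  let s : N → Setoid L := fun t ↦
    { r := fun x y ↦ w (x - y) ≤ w (algebraMap N L t)
      iseqv :=
        { refl := fun x ↦ by simp
          symm := fun {x y} hxy ↦ by rwa [Valuation.map_sub_swap]
          trans := fun {x y z} hxy hyz ↦ by
            have : x - z = (x - y) + (y - z) := by ring
            rw [this]
            exact Valuation.map_add_le _ hxy hyz } }
  -- `ctr t x` is a chosen centre of the closed ball of radius $w(t)$ around $x$, and `f x t` is a
  -- digit $d\in N$ approximating $(x-\mathrm{ctr})/t$. These digits determine $x$: if
  -- $w(t)=w(x-y)$, then $x$ and $y$ share the centre, and equal digits would give $w(x-y)<w(t)$.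
  let ctr : N → L → L := fun t x ↦ (Quotient.mk (s t) x).out
  let P : N → L → N → Prop := fun t x d ↦
    w (x - ctr t x - algebraMap N L d * algebraMap N L t) < w (algebraMap N L t)
  let f : L → N → N := fun x t ↦ if hd : ∃ d, P t x d then hd.choose else 0
  refine Cardinal.mk_le_of_injective (f := f) fun x y hxy ↦ ?_
  by_contra hne
  have hxy0 : x - y ≠ 0 := sub_ne_zero.2 hne
  obtain ⟨t, ht⟩ := h.exists_val_eq (x - y)
  have ht0 : algebraMap N L t ≠ 0 := by
    rw [← w.ne_zero_iff, ht]
    exact w.ne_zero_iff.2 hxy0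
  have hctr : ctr t x = ctr t y := by
    have : Quotient.mk (s t) x = Quotient.mk (s t) y := Quotient.sound ht.ge
    simp only [ctr, this]
  have hex : ∀ z, ∃ d, P t z d := by
    intro z
    have hz : w (z - ctr t z) ≤ w (algebraMap N L t) := by
      rw [Valuation.map_sub_swap]
      exact Quotient.mk_out (s := s t) z
    have hwt : 0 < w (algebraMap N L t) := zero_lt_iff.2 (w.ne_zero_iff.2 ht0)
    obtain ⟨d, hd⟩ := h.exists_sub_lt_one (x := (z - ctr t z) / algebraMap N L t)
      (by rwa [map_div₀, div_le_one₀ hwt])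
    refine ⟨d, ?_⟩
    have : z - ctr t z - algebraMap N L d * algebraMap N L t =
      ((z - ctr t z) / algebraMap N L t - algebraMap N L d) * algebraMap N L t := by
      field_simp
    show w _ < _
    rw [this, map_mul]
    exact mul_lt_of_lt_one_left hwt hd
  have hf : ∀ z, P t z (f z t) := by
    intro z
    have : f z t = (hex z).choose := dif_pos (hex z)
    rw [this]
    exact (hex z).choose_spec
  have h1 := hf x
  have h2 := hf y
  rw [← hxy] at h2
  have : w (x - y) < w (algebraMap N L t) := by
    have e : x - y = (x - ctr t x - algebraMap N L (f x t) * algebraMap N L t) -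
      (y - ctr t y - algebraMap N L (f x t) * algebraMap N L t) := by
      rw [hctr]
      ring
    rw [e]
    exact Valuation.map_sub_lt _ h1 h2
  exact absurd this (not_lt.2 ht.le)

/-- Every valued field has a spherically complete immediate extension. -/
theorem exists_sphericallyComplete_immediate (v : Valuation N Γ) :
    ∃ (L : Type u) (_ : Field L) (_ : Algebra N L) (A : ValuationSubring L),
      v.HasExtension A.valuation ∧ ApproxBy N A.valuation ∧
      ∀ {Δ : Type u} [LinearOrderedCommGroupWithZero Δ] (w : Valuation L Δ),
        A.valuation.IsEquiv w → SphericallyCompleteOn w Set.univ := by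
  -- The power set makes $\Omega$ larger than $\max(|N\to N|,\aleph_0)$, hence too large to be
  -- algebraic over any immediate extension of $N$.
  let I : Type u := Set ((N → N) ⊕ ULift.{u} ℕ)
  let Ω := AlgebraicClosure (FractionRing (MvPolynomial I N))
  have hI : max (Cardinal.mk (N → N)) Cardinal.aleph0 < Cardinal.mk Ω := by
    have h1 : max (Cardinal.mk (N → N)) Cardinal.aleph0 ≤ Cardinal.mk ((N → N) ⊕ ULift.{u} ℕ) := by
      rw [Cardinal.mk_sum]
      simp
    refine h1.trans_lt ((Cardinal.cantor _).trans_le ?_)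
    rw [← Cardinal.mk_set]
    refine Cardinal.mk_le_of_injective (f := fun i : I ↦ algebraMap (FractionRing (MvPolynomial I N)) Ω
      (algebraMap (MvPolynomial I N) _ (MvPolynomial.X i))) ?_
    intro i j hij
    exact MvPolynomial.X_injective (IsFractionRing.injective (MvPolynomial I N)
      (FractionRing (MvPolynomial I N)) ((algebraMap _ Ω).injective hij))
  obtain ⟨E, A, hA, happ, hmax⟩ := exists_maximal_immediate_subextension Ω v
  refine ⟨E, inferInstance, inferInstance, A, hA, happ, ?_⟩
  intro Δ _ w hw
  by_contra hsc
  obtain ⟨M, _, _, w', hw', happ', hns, hemb⟩ := exists_immediate_of_not_sphericallyCompleteOn hsc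
  have htr : Algebra.Transcendental E Ω := by
    by_contra hcon
    rw [Algebra.transcendental_iff_not_isAlgebraic, not_not] at hcon
    have := Algebra.IsAlgebraic.cardinalMk_le_max E Ω
    exact absurd hI (not_lt.2 (this.trans (max_le_max happ.cardinalMk_le le_rfl)))
  obtain ⟨σ⟩ := hemb Ω htr
  let _ : Algebra N M := ((algebraMap E M).comp (algebraMap N E)).toAlgebra
  have _ : IsScalarTower N E M := .of_algebraMap_eq fun _ ↦ rfl
  refine hns (hmax w' ⟨hw' ▸ hw⟩ (happ'.trans ?_) σ)
  rw [hw']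
  exact happ.isEquiv hw

end Cardinality
end HenselRat

namespace HenselRat
open IsLocalRing

/-! ### Spherical completeness implies henselianity -/

section Hensel

variable {L : Type*} [Field L] {Γ : Type*} [LinearOrderedCommGroupWithZero Γ]

/-- Spherically complete valued fields are henselian. -/
theorem SphericallyCompleteOn.isHenselian {w : Valuation L Γ}
    (h : SphericallyCompleteOn w Set.univ) : IsHenselian w := by
  refine { is_henselian := fun f _ a₀ hf0 hf' ↦ ?_ }
  let A := w.valuationSubring
  have hm : ∀ x : A, x ∈ maximalIdeal A ↔ w (x : L) < 1 := fun x ↦ w.mem_maximalIdeal_iff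
  have hunit : ∀ x : A, IsUnit x → w (x : L) = 1 := fun x hx ↦
    (Valuation.integer.integers w).one_of_isUnit hx
  let C : Set A := {c | c - a₀ ∈ maximalIdeal A}
  have hCm : ∀ c, c ∈ C ↔ c - a₀ ∈ maximalIdeal A := fun _ ↦ Iff.rfl
  have hC' : ∀ c ∈ C, IsUnit (f.derivative.eval c) := by
    intro c hc
    by_contra hcon
    have h1 : f.derivative.eval c - f.derivative.eval a₀ ∈ maximalIdeal A :=
      Ideal.mem_of_dvd _ (Polynomial.sub_dvd_eval_sub c a₀ f.derivative) hc
    have h2 : f.derivative.eval a₀ ∈ maximalIdeal A := by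
      have := Ideal.sub_mem _ ((mem_maximalIdeal _).2 hcon) h1
      rwa [sub_sub_cancel] at this
    exact (mem_maximalIdeal _).1 h2 hf'
  have hCf : ∀ c ∈ C, w (f.eval c : A) < 1 := by
    intro c hc
    rw [← hm]
    have h1 : f.eval c - f.eval a₀ ∈ maximalIdeal A :=
      Ideal.mem_of_dvd _ (Polynomial.sub_dvd_eval_sub c a₀ f) hc
    have := Ideal.add_mem _ h1 hf0
    simpa using this
  -- As $f'$ takes unit values on $C$, the difference $f(d)-f(c)$ is a unit times $d-c$.
  have hdist : ∀ c ∈ C, ∀ d ∈ C, w ((f.eval d : A) - (f.eval c : A) : L) = w ((d : L) - c) := by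
    intro c hc d hd
    obtain ⟨k, hk⟩ := f.exists_mul_sq_add_linear_part_eq_eval_add c (d - c)
    have hdc : d - c ∈ maximalIdeal A := by
      have := Ideal.sub_mem _ ((hCm d).1 hd) ((hCm c).1 hc)
      rwa [sub_sub_sub_cancel_right] at this
    have hfac : f.eval d - f.eval c = (d - c) * (f.derivative.eval c + k * (d - c)) := by
      rw [add_sub_cancel] at hk
      rw [← hk]
      ring
    have hu : IsUnit (f.derivative.eval c + k * (d - c)) := by
      by_contra hcon
      have := Ideal.sub_mem _ ((mem_maximalIdeal _).2 hcon) (Ideal.mul_mem_left _ k hdc)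
      rw [add_sub_cancel_right] at this
      exact (mem_maximalIdeal _).1 this (hC' c hc)
    have := congrArg (fun x : A ↦ w (x : L)) hfac
    simp only [MulMemClass.coe_mul, map_mul, hunit _ hu, mul_one] at this
    exact this
  -- By `hdist` a root in $C$ would have distance exactly $w(f(c))$ from each $c$. A common point
  -- $b$ of these balls minimizes $w(f(\cdot))$ on $C$.
  let S : Set (L × Γ) := (fun c : A ↦ ((c : L), w (f.eval c : A))) '' C
  have hS : IsNest w S := by
    rintro _ ⟨c, hc, rfl⟩ _ ⟨d, hd, rfl⟩
    show w ((c : L) - d) ≤ max (w (f.eval c : A)) (w (f.eval d : A))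
    rw [← hdist d hd c hc]
    exact w.map_sub _ _
  obtain ⟨b, -, hb⟩ := h S (fun _ _ ↦ trivial) hS
  have hb' : ∀ c ∈ C, w (b - c) ≤ w (f.eval c : A) := fun c hc ↦ hb _ ⟨c, hc, rfl⟩
  have ha₀ : a₀ ∈ C := by
    rw [hCm, sub_self]
    exact zero_mem _
  have hba : w (b - a₀) < 1 := (hb' a₀ ha₀).trans_lt (hCf a₀ ha₀)
  have hbA : b ∈ A := by
    have : b = (b - a₀) + a₀ := by ring
    rw [this]
    exact A.add_mem _ _ hba.le a₀.2
  lift b to A using hbA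
  have hbC : b ∈ C := (hm _).2 hba
  refine ⟨b, ?_, hbC⟩
  have hmin : ∀ c ∈ C, w (f.eval b : A) ≤ w (f.eval c : A) := by
    intro c hc
    have e : ((f.eval b : A) : L) = ((f.eval b : A) - (f.eval c : A)) + (f.eval c : A) := by ring
    rw [e]
    refine Valuation.map_add_le _ ?_ le_rfl
    rw [hdist c hc b hbC]
    exact hb' c hc
  by_contra hne
  obtain ⟨u, hu⟩ := hC' b hbC
  -- A Newton step from $b$: it gives $w(f(b+y))\le w(f(b))^2<w(f(b))$, against minimality.
  let y : A := -(f.eval b * ↑u⁻¹)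
  have hwy : w (y : L) ≤ w (f.eval b : A) := by
    simp only [y, NegMemClass.coe_neg, Valuation.map_neg, MulMemClass.coe_mul, map_mul,
      hunit _ (Units.isUnit u⁻¹), mul_one, le_refl]
  have hyC : b + y ∈ C := by
    rw [hCm]
    have e : b + y - a₀ = (b - a₀) + y := by ring
    rw [e]
    exact Ideal.add_mem _ hbC ((hm _).2 (hwy.trans_lt (hCf b hbC)))
  obtain ⟨k, hk⟩ := f.exists_mul_sq_add_linear_part_eq_eval_add b y
  have hlin : f.derivative.eval b * y + f.eval b = 0 := by
    rw [← hu]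
    simp only [y]
    rw [mul_neg, mul_comm (f.eval b), ← mul_assoc, Units.mul_inv, one_mul, neg_add_cancel]
  have hval : f.eval (b + y) = k * y ^ 2 := by
    rw [← hk, add_assoc, hlin, add_zero]
  have h1 := hmin _ hyC
  rw [hval] at h1
  have hpos : 0 < w (f.eval b : A) := by
    rw [zero_lt_iff, w.ne_zero_iff]
    intro h0
    exact hne (Subtype.ext h0)
  have h2 : w ((k * y ^ 2 : A) : L) < w (f.eval b : A) := by
    calc w ((k * y ^ 2 : A) : L) = w (k : L) * w (y : L) ^ 2 := by simp
      _ ≤ 1 * w (f.eval b : A) ^ 2 := mul_le_mul' k.2 (pow_le_pow_left₀ zero_le hwy 2)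
      _ = w (f.eval b : A) * w (f.eval b : A) := by rw [one_mul, sq]
      _ < w (f.eval b : A) := mul_lt_of_lt_one_left hpos (hCf b hbC)
  exact absurd h1 (not_le.2 h2)

end Hensel

/-! ### Finite-dimensional spaces over spherically complete fields -/

section Span

variable {N M : Type*} [Field N] [Field M] [Algebra N M]
  {Γ : Type*} [LinearOrderedCommGroupWithZero Γ] {w : Valuation M Γ}

/-- Best approximation by elements of spherically complete sets. -/
theorem SphericallyCompleteOn.exists_best_approx {U : Set M} (h : SphericallyCompleteOn w U)
    (z : M) : ∃ u ∈ U, ∀ u' ∈ U, w (z - u) ≤ w (z - u') := by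
  obtain ⟨x, hxU, hx⟩ := h ((fun u ↦ (u, w (z - u))) '' U)
    (by rintro _ ⟨u, hu, rfl⟩; exact hu)
    (by
      rintro _ ⟨a, -, rfl⟩ _ ⟨b, -, rfl⟩
      have : a - b = (z - b) - (z - a) := by ring
      show w (a - b) ≤ _
      rw [this, max_comm]
      exact w.map_sub _ _)
  refine ⟨x, hxU, fun u hu ↦ ?_⟩
  have : z - x = (z - u) - (x - u) := by ring
  rw [this]
  exact Valuation.map_sub_le _ le_rfl (hx _ ⟨u, hu, rfl⟩)

/-- Subtracting from $z$ its best approximation in $U$ gives $y$ orthogonal to $U$: neither $u'$ nor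
$cy$ has larger value than $u'+cy$. Every nest in the sum therefore splits into a nest in $U$ and a
nest of coefficients in $N$. -/
theorem SphericallyCompleteOn.sup_span_singleton
    (hN : SphericallyCompleteOn (w.comap (algebraMap N M)) Set.univ) {U : Submodule N M}
    (hU : SphericallyCompleteOn w (U : Set M)) (z : M) :
    SphericallyCompleteOn w ((U ⊔ Submodule.span N {z} : Submodule N M) : Set M) := by
  by_cases hz : z ∈ U
  · rwa [sup_eq_left.2 (Submodule.span_le.2 (Set.singleton_subset_iff.2 hz))]
  obtain ⟨u, hu, hbest⟩ := hU.exists_best_approx z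
  set y := z - u with hy
  have hy0 : w y ≠ 0 := by
    rw [w.ne_zero_iff, hy, sub_ne_zero]
    rintro rfl
    exact hz hu
  have hmem : ∀ x, x ∈ U ⊔ Submodule.span N {z} ↔ ∃ u' ∈ U, ∃ c : N, x = u' + c • y := by
    intro x
    rw [Submodule.mem_sup]
    constructor
    · rintro ⟨u', hu', _, hc, rfl⟩
      obtain ⟨c, rfl⟩ := Submodule.mem_span_singleton.1 hc
      refine ⟨u' + c • u, U.add_mem hu' (U.smul_mem c hu), c, ?_⟩
      rw [hy, smul_sub]
      ring
    · rintro ⟨u', hu', c, rfl⟩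
      refine ⟨u' - c • u, U.sub_mem hu' (U.smul_mem c hu), c • z,
        Submodule.smul_mem _ c (Submodule.mem_span_singleton_self z), ?_⟩
      rw [hy, smul_sub]
      ring
  have horth : ∀ u' ∈ U, ∀ c : N, w (c • y) ≤ w (u' + c • y) := by
    intro u' hu' c
    by_cases hc : c = 0
    · simp [hc]
    have h1 := hbest (u - c⁻¹ • u') (U.sub_mem hu (U.smul_mem _ hu'))
    have h2 : u' + c • y = c • (z - (u - c⁻¹ • u')) := by
      rw [hy, sub_sub_eq_add_sub, smul_sub, smul_sub, smul_add, smul_smul, mul_inv_cancel₀ hc,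
        one_smul]
      ring
    rw [h2, Algebra.smul_def, Algebra.smul_def, map_mul, map_mul]
    exact mul_le_mul_right h1 _
  have horth' : ∀ u' ∈ U, ∀ c : N, w u' ≤ w (u' + c • y) := by
    intro u' hu' c
    have : u' = (u' + c • y) - c • y := by ring
    conv_lhs => rw [this]
    exact Valuation.map_sub_le _ le_rfl (horth u' hu' c)
  intro S hSU hS
  choose! f hf g hg using fun a (ha : a ∈ S) ↦ (hmem a.1).1 (hSU a ha)
  have hdiff : ∀ a ∈ S, ∀ b ∈ S, a.1 - b.1 = (f a - f b) + (g a - g b) • y := by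
    intro a ha b hb
    rw [hg a ha, hg b hb, sub_smul]
    ring
  obtain ⟨c, -, hc⟩ := hN ((fun a ↦ (g a, a.2 / w y)) '' S) (fun _ _ ↦ trivial) (by
    rintro _ ⟨a, ha, rfl⟩ _ ⟨b, hb, rfl⟩
    have h1 := hS a ha b hb
    rw [hdiff a ha b hb] at h1
    have h2 := (horth _ (U.sub_mem (hf a ha) (hf b hb)) _).trans h1
    rw [Algebra.smul_def, map_mul] at h2
    exact (le_max_iff.1 h2).elim
      (fun h ↦ le_max_of_le_left ((le_div_iff₀ (zero_lt_iff.2 hy0)).2 h))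
      (fun h ↦ le_max_of_le_right ((le_div_iff₀ (zero_lt_iff.2 hy0)).2 h)))
  obtain ⟨d, hd, hdS⟩ := hU ((fun a ↦ (f a, a.2)) '' S)
    (by rintro _ ⟨a, ha, rfl⟩; exact hf a ha) (by
    rintro _ ⟨a, ha, rfl⟩ _ ⟨b, hb, rfl⟩
    have h1 := hS a ha b hb
    rw [hdiff a ha b hb] at h1
    exact (horth' _ (U.sub_mem (hf a ha) (hf b hb)) _).trans h1)
  refine ⟨d + c • y, (hmem _).2 ⟨d, hd, c, rfl⟩, fun a ha ↦ ?_⟩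
  have : d + c • y - a.1 = (d - f a) + (c - g a) • y := by
    rw [hg a ha, sub_smul]
    ring
  rw [this]
  refine Valuation.map_add_le _ (hdS _ ⟨a, ha, rfl⟩) ?_
  rw [Algebra.smul_def, map_mul, ← le_div_iff₀ (zero_lt_iff.2 hy0)]
  exact hc _ ⟨a, ha, rfl⟩

theorem SphericallyCompleteOn.of_fg
    (hN : SphericallyCompleteOn (w.comap (algebraMap N M)) Set.univ) {U : Submodule N M}
    (hU : U.FG) : SphericallyCompleteOn w (U : Set M) := by
  classical
  obtain ⟨s, rfl⟩ := hU
  induction s using Finset.induction_on with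
  | empty =>
    intro S hSU _
    refine ⟨0, by simp, fun a ha ↦ ?_⟩
    have : a.1 = 0 := by simpa using hSU a ha
    simp [this]
  | insert z s _ ih =>
    rw [Finset.coe_insert, Submodule.span_insert, sup_comm]
    exact hN.sup_span_singleton ih z

/-- Finite extensions of spherically complete fields are spherically complete. -/
theorem SphericallyCompleteOn.of_finiteDimensional [FiniteDimensional N M]
    (hN : SphericallyCompleteOn (w.comap (algebraMap N M)) Set.univ) :
    SphericallyCompleteOn w Set.univ := by
  simpa using hN.of_fg (Module.Finite.fg_top (R := N) (M := M))

/-- Over a spherically complete field, a finitely generated subspace that approximates all elements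
is the whole space. -/
theorem SphericallyCompleteOn.eq_top_of_approx
    (hN : SphericallyCompleteOn (w.comap (algebraMap N M)) Set.univ) {U : Submodule N M}
    (hU : U.FG) (happ : ∀ x : M, x ≠ 0 → ∃ u ∈ U, w (x - u) < w x) : U = ⊤ := by
  rw [eq_top_iff]
  intro z _
  obtain ⟨u, hu, hbest⟩ := (hN.of_fg hU).exists_best_approx z
  by_contra hz
  have hne : z - u ≠ 0 := by
    rw [sub_ne_zero]
    rintro rfl
    exact hz hu
  obtain ⟨u', hu', hlt⟩ := happ _ hne
  have := hbest (u + u') (U.add_mem hu hu')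
  rw [← sub_sub] at this
  exact absurd hlt (not_lt.2 this)

end Span
end HenselRat

namespace HenselRat
open IsLocalRing TensorProduct

/-! ### Common extensions of valuations to a compositum -/

section CommonExtension

variable {N L M : Type*} {E : Type u} [Field N] [Field E] [Field L] [Field M] [Algebra N E] [Algebra N L]
  [Algebra N M] [Algebra E M] [Algebra L M] [IsScalarTower N E M] [IsScalarTower N L M]
  {Γ Γ₁ Γ₂ : Type*} [LinearOrderedCommGroupWithZero Γ] [LinearOrderedCommGroupWithZero Γ₁]
  [LinearOrderedCommGroupWithZero Γ₂]

/-- The embedding of the valuation ring of a subfield, as an algebra homomorphism. -/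
def valuationSubringAlgHom (v : Valuation N Γ) (w : Valuation E Γ₁) [v.HasExtension w]
    (M : Type*) [Field M] [Algebra N M] [Algebra E M] [IsScalarTower N E M] :
    w.valuationSubring →ₐ[v.valuationSubring] M :=
  { (algebraMap E M).comp w.valuationSubring.subtype with
    commutes' := fun c ↦ (IsScalarTower.algebraMap_apply N E M (c : N)).symm }

theorem valuationSubringAlgHom_apply (v : Valuation N Γ) (w : Valuation E Γ₁) [v.HasExtension w]
    (x : w.valuationSubring) : valuationSubringAlgHom v w M x = algebraMap E M x := rfl

theorem isTorsionFree_valuationSubring (v : Valuation N Γ) (w : Valuation E Γ₁)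
    [v.HasExtension w] : Module.IsTorsionFree v.valuationSubring w.valuationSubring := by
  refine .of_smul_eq_zero fun r x h ↦ ?_
  have h' := congrArg (fun z : w.valuationSubring ↦ (z : E)) h
  rw [Algebra.smul_def] at h'
  simpa using h'

/-- A given tensor comes from $P\otimes\mathcal O_L$ with $P\subseteq\mathcal O_E$ finitely
generated. Over the valuation ring of $N$ the torsion-free module $P$ is flat, hence free. A basis
of it is $N$-independent in $E$, so $L$-independent in $M$ by disjointness. -/
theorem productMap_valuationSubring_injective (v : Valuation N Γ) (wE : Valuation E Γ₁)
    (wL : Valuation L Γ₂) [v.HasExtension wE] [v.HasExtension wL]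
    (hdisj : ∀ {ι : Type u} (x : ι → E), LinearIndependent N x →
      LinearIndependent L (fun i ↦ algebraMap E M (x i))) :
    Function.Injective (Algebra.TensorProduct.productMap (valuationSubringAlgHom v wE M)
      (valuationSubringAlgHom v wL M)) := by
  rw [injective_iff_map_eq_zero]
  intro t ht
  obtain ⟨P, hP, hPt⟩ := TensorProduct.exists_finite_submodule_left_of_setFinite {t}
    (Set.finite_singleton t)
  obtain ⟨t', rfl⟩ := hPt (Set.mem_singleton t)
  have := isTorsionFree_valuationSubring v wE
  have hflat : Module.Flat v.valuationSubring P := by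
    rw [Module.Flat.flat_iff_torsion_eq_bot_of_isBezout,
      ← Submodule.isTorsionFree_iff_torsion_eq_bot]
    infer_instance
  have hfree : Module.Free v.valuationSubring P := Module.free_of_flat_of_isLocalRing
  let b := Module.Free.chooseBasis v.valuationSubring P
  obtain ⟨c, rfl⟩ := TensorProduct.eq_repr_basis_left b t'
  have hli : LinearIndependent N (fun i ↦ ((b i : wE.valuationSubring) : E)) := by
    rw [← LinearIndependent.iff_fractionRing (R := v.valuationSubring)]
    let f : P →ₗ[v.valuationSubring] E :=
      (IsScalarTower.toAlgHom v.valuationSubring wE.valuationSubring E).toLinearMap.comp P.subtype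
    refine b.linearIndependent.map' f (LinearMap.ker_eq_bot.2 ?_)
    intro x y hxy
    exact Subtype.ext (Subtype.ext hxy)
  have hli' := hdisj _ hli
  have hzero : ∑ i ∈ c.support, (c i : L) • algebraMap E M (b i : wE.valuationSubring) = 0 := by
    rw [← ht, Finsupp.sum, map_sum, map_sum]
    refine Finset.sum_congr rfl fun i _ ↦ ?_
    rw [LinearMap.rTensor_tmul, Algebra.TensorProduct.productMap_apply_tmul,
      valuationSubringAlgHom_apply, valuationSubringAlgHom_apply, Algebra.smul_def, mul_comm]
    rfl
  have hc : c = 0 := by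
    ext i
    by_cases hi : i ∈ c.support
    · exact linearIndependent_iff'.1 hli' _ _ hzero i hi
    · simpa using hi
  simp [hc]

/-- Valuations of `E` and of an immediate extension `L` of `N` that agree on `N` have a common
extension to every compositum in which `E` and `L` are linearly disjoint over `N`. -/
theorem exists_common_extension (v : Valuation N Γ) (wE : Valuation E Γ₁)
    (wL : Valuation L Γ₂) [v.HasExtension wE] [v.HasExtension wL] (himm : IsImmediate v wL)
    (hdisj : ∀ {ι : Type u} (x : ι → E), LinearIndependent N x →
      LinearIndependent L (fun i ↦ algebraMap E M (x i))) :
    ∃ A : ValuationSubring M, wE.HasExtension A.valuation ∧ wL.HasExtension A.valuation := by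
  let ψ := Algebra.TensorProduct.productMap (valuationSubringAlgHom v wE M)
      (valuationSubringAlgHom v wL M)
  have hψ : Function.Injective ψ := productMap_valuationSubring_injective v wE wL hdisj
  -- Since $Lw=Nv$, the residue map of $L$ lands in $Ew$ and combines with that of $E$ to
  -- $\varphi:\mathcal O_E\otimes\mathcal O_L\to Ew$.
  let e : Residue v ≃+* Residue wL := RingEquiv.ofBijective (algebraMap (Residue v) (Residue wL))
    ⟨(algebraMap (Residue v) (Residue wL)).injective, himm.residue_surjective⟩
  let f : wE.valuationSubring →ₐ[v.valuationSubring] Residue wE :=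
    IsScalarTower.toAlgHom v.valuationSubring wE.valuationSubring (Residue wE)
  let g : wL.valuationSubring →ₐ[v.valuationSubring] Residue wE :=
    { ((algebraMap (Residue v) (Residue wE)).comp (e.symm : Residue wL →+* Residue v)).comp
        (residue wL.valuationSubring) with
      commutes' := fun c ↦ by
        have h1 : e.symm (residue _ (algebraMap v.valuationSubring wL.valuationSubring c)) =
            residue _ c := by
          rw [RingEquiv.symm_apply_eq]
          rfl
        show algebraMap (Residue v) (Residue wE) (e.symm (residue _ (algebraMap _ _ c))) = _
        rw [h1]
        rfl }
  let φ := Algebra.TensorProduct.productMap f g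
  let R : Subring M := ψ.toRingHom.range
  -- Proper because $\psi$ is injective and $\varphi(1)\neq 0$. A valuation ring containing $R$ in
  -- which $I$ consists of nonunits dominates $\mathcal O_E$ and $\mathcal O_L$.
  let I : Ideal R := (RingHom.ker φ).map ψ.toRingHom.rangeRestrict
  have hI : I ≠ ⊤ := by
    rw [Ne, Ideal.eq_top_iff_one]
    intro h
    obtain ⟨t, ht, ht1⟩ := (Ideal.mem_map_iff_of_surjective _
      ψ.toRingHom.rangeRestrict_surjective).1 h
    have ht1' : ψ t = ψ 1 := by
      rw [map_one]
      exact congrArg Subtype.val ht1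
    have := hψ ht1'
    rw [this, RingHom.mem_ker, map_one] at ht
    exact one_ne_zero ht
  obtain ⟨A, hRA, hIA⟩ := Ideal.image_subset_nonunits_valuationSubring I hI
  have hmem : ∀ t, ψ t ∈ A := fun t ↦ hRA ⟨t, rfl⟩
  have hnon : ∀ t, φ t = 0 → A.valuation (ψ t) < 1 := by
    intro t ht
    have h1 : ψ.toRingHom.rangeRestrict t ∈ I := Ideal.mem_map_of_mem _ ht
    exact (ValuationSubring.mem_nonunits_iff A).1 (hIA ⟨_, h1, rfl⟩)
  have hψE : ∀ x : wE.valuationSubring, ψ (x ⊗ₜ 1) = algebraMap E M x := by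
    intro x
    rw [Algebra.TensorProduct.productMap_apply_tmul, map_one, mul_one]
    rfl
  have hψL : ∀ x : wL.valuationSubring, ψ (1 ⊗ₜ x) = algebraMap L M x := by
    intro x
    rw [Algebra.TensorProduct.productMap_apply_tmul, map_one, one_mul]
    rfl
  refine ⟨A, hasExtension_of_le_one_of_lt_one ?_ ?_, hasExtension_of_le_one_of_lt_one ?_ ?_⟩
  · intro x hx
    rw [ValuationSubring.valuation_le_one_iff, ← hψE ⟨x, hx⟩]
    exact hmem _
  · intro x hx
    rw [← hψE ⟨x, hx.le⟩]
    refine hnon _ ?_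
    rw [Algebra.TensorProduct.productMap_apply_tmul, map_one, mul_one]
    show residue _ _ = 0
    rw [residue_eq_zero_iff, Valuation.mem_maximalIdeal_iff]
    exact hx
  · intro x hx
    rw [ValuationSubring.valuation_le_one_iff, ← hψL ⟨x, hx⟩]
    exact hmem _
  · intro x hx
    rw [← hψL ⟨x, hx.le⟩]
    refine hnon _ ?_
    rw [Algebra.TensorProduct.productMap_apply_tmul, map_one, one_mul]
    show algebraMap (Residue v) (Residue wE) (e.symm (residue _ _)) = 0
    have : residue wL.valuationSubring ⟨x, hx.le⟩ = 0 := by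
      rw [residue_eq_zero_iff, Valuation.mem_maximalIdeal_iff]
      exact hx
    rw [this, map_zero, map_zero]

end CommonExtension
end HenselRat

namespace HenselRat
open IsLocalRing

/-! ### Independence and approximation by $ef$ elements -/

section Fundamental

variable {N E : Type*} [Field N] [Field E] [Algebra N E]
  {Γ Γ' : Type*} [LinearOrderedCommGroupWithZero Γ] [LinearOrderedCommGroupWithZero Γ']
  (v : Valuation N Γ) (w : Valuation E Γ') [v.HasExtension w]

/-- Divide by a coefficient of largest value. A sum of smaller value would reduce to a linear
relation between the residues in which one coefficient is $1$. -/
theorem val_le_val_sum_of_linearIndependent_residue {κ : Type*} {y : κ → w.valuationSubring}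
    (hy : LinearIndependent (Residue v) (fun k ↦ residue _ (y k))) (s : Finset κ) (c : κ → N)
    {k : κ} (hk : k ∈ s) : w (algebraMap N E (c k)) ≤ w (∑ j ∈ s, algebraMap N E (c j) * y j) := by
  obtain ⟨m, hm, hmax⟩ := s.exists_max_image (fun j ↦ w (algebraMap N E (c j))) ⟨k, hk⟩
  refine (hmax k hk).trans ?_
  by_contra! hlt
  have hcm : w (algebraMap N E (c m)) ≠ 0 := (zero_le.trans_lt hlt).ne'
  have hcm0 : algebraMap N E (c m) ≠ 0 := by simpa using hcm
  have hint : ∀ j ∈ s, v (c j / c m) ≤ 1 := by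
    intro j hj
    rw [← Valuation.HasExtension.val_map_le_one_iff v w, map_div₀, map_div₀,
      div_le_one₀ (zero_lt_iff.2 hcm)]
    exact hmax j hj
  classical
  let d : κ → v.valuationSubring := fun j ↦ if hj : j ∈ s then ⟨c j / c m, hint j hj⟩ else 0
  have hd : ∀ j ∈ s, (d j : N) = c j / c m := fun j hj ↦ by simp [d, hj]
  have hsum : ∑ j ∈ s, residue v.valuationSubring (d j) • residue w.valuationSubring (y j) = 0 := by
    have h1 : ∀ j, residue v.valuationSubring (d j) • residue w.valuationSubring (y j) =
        residue w.valuationSubring (algebraMap v.valuationSubring w.valuationSubring (d j) * y j) := by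
      intro j
      rw [Algebra.smul_def, map_mul]
      rfl
    simp_rw [h1]
    rw [← map_sum, residue_eq_zero_iff, Valuation.mem_maximalIdeal_iff]
    have h2 : ((∑ j ∈ s, algebraMap v.valuationSubring w.valuationSubring (d j) * y j :
        w.valuationSubring) : E) = (∑ j ∈ s, algebraMap N E (c j) * y j) / algebraMap N E (c m) := by
      rw [AddSubmonoidClass.coe_finsetSum, Finset.sum_div]
      refine Finset.sum_congr rfl fun j hj ↦ ?_
      rw [MulMemClass.coe_mul, Valuation.HasExtension.coe_algebraMap_valuationSubring_eq, hd j hj,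
        map_div₀]
      ring
    rw [h2, map_div₀, div_lt_one₀ (zero_lt_iff.2 hcm)]
    exact hlt
  have h0 := linearIndependent_iff'.1 hy s _ hsum m hm
  rw [residue_eq_zero_iff, Valuation.mem_maximalIdeal_iff, hd m hm,
    div_self (by simpa using hcm0), map_one] at h0
  exact lt_irrefl _ h0

/-- A family of representatives of the cosets of the smaller value group in the larger one, times a
family of lifts of linearly independent residues, is linearly independent. -/
theorem linearIndependent_mul_of_valueGrp_of_residue {ι κ : Type*} {x : ι → E}
    (hx0 : ∀ i, x i ≠ 0)
    (hx : ∀ i j, i ≠ j → ∀ c : N, w (x i) ≠ w (algebraMap N E c) * w (x j))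
    {y : κ → w.valuationSubring}
    (hy : LinearIndependent (Residue v) (fun k ↦ residue _ (y k))) :
    LinearIndependent N (fun p : ι × κ ↦ x p.1 * y p.2) := by
  classical
  rw [linearIndependent_iff']
  intro s g hg p hp
  -- Extended by zero from $s$ to the product of its projections, so that the sum can be grouped by
  -- value cosets.
  let g' : ι × κ → N := fun p ↦ if p ∈ s then g p else 0
  have hg' : ∑ i ∈ s.image Prod.fst, x i * ∑ k ∈ s.image Prod.snd,
      algebraMap N E (g' (i, k)) * y k = 0 := by
    rw [← hg]
    have h1 : ∑ p ∈ s, g p • (x p.1 * (y p.2 : E)) =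
        ∑ p ∈ s.image Prod.fst ×ˢ s.image Prod.snd, g' p • (x p.1 * (y p.2 : E)) := by
      refine Eq.trans (b := ∑ p ∈ s, g' p • (x p.1 * (y p.2 : E))) ?_ (Finset.sum_subset ?_ ?_)
      · refine Finset.sum_congr rfl fun p hp ↦ ?_
        simp [g', hp]
      · intro p hp
        exact Finset.mem_product.2 ⟨Finset.mem_image_of_mem _ hp, Finset.mem_image_of_mem _ hp⟩
      · intro p _ hp
        simp [g', hp]
    rw [h1, Finset.sum_product]
    refine Finset.sum_congr rfl fun i _ ↦ ?_
    rw [Finset.mul_sum]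
    refine Finset.sum_congr rfl fun k _ ↦ ?_
    rw [Algebra.smul_def]
    ring
  set z : ι → E := fun i ↦ ∑ k ∈ s.image Prod.snd, algebraMap N E (g' (i, k)) * y k with hz
  have hle : ∀ i, ∀ k ∈ s.image Prod.snd, w (algebraMap N E (g' (i, k))) ≤ w (z i) :=
    fun i k hk ↦ val_le_val_sum_of_linearIndependent_residue v w hy _ (fun k ↦ g' (i, k)) hk
  have hzv : ∀ i, ∃ c : N, w (z i) = w (algebraMap N E c) := by
    intro i
    obtain ⟨m, hm, hmax⟩ := (s.image Prod.snd).exists_max_image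
      (fun k ↦ w (algebraMap N E (g' (i, k)))) ⟨p.2, Finset.mem_image_of_mem _ hp⟩
    refine ⟨g' (i, m), le_antisymm ?_ (hle i m hm)⟩
    refine Valuation.map_sum_le w fun k hk ↦ ?_
    rw [map_mul]
    exact (mul_le_of_le_one_right' (y k).2).trans (hmax k hk)
  have hpi : p.1 ∈ s.image Prod.fst := Finset.mem_image_of_mem _ hp
  have hpk : p.2 ∈ s.image Prod.snd := Finset.mem_image_of_mem _ hp
  -- Each nonzero $z_i$ has a value from $N$, so the nonzero terms $x_iz_i$ have values in distinct
  -- cosets.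
  have hzero : w (x p.1 * z p.1) ≤ 0 := by
    rw [← w.map_zero, ← hg']
    refine val_le_val_sum_of_pairwise_ne (f := fun i ↦ x i * z i) ?_ hpi
    intro i _ j _ hij h0 heq
    obtain ⟨c, hc⟩ := hzv i
    obtain ⟨d, hd⟩ := hzv j
    rw [map_mul, hc] at h0
    rw [map_mul, map_mul, hc, hd] at heq
    have hc0 := right_ne_zero_of_mul h0
    refine hx i j hij (d / c) ?_
    rw [map_div₀, map_div₀, div_mul_eq_mul_div, eq_div_iff hc0, heq, mul_comm]
  have hzp : z p.1 = 0 := by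
    have h1 : x p.1 * z p.1 = 0 := w.zero_iff.1 (le_antisymm hzero zero_le)
    exact (mul_eq_zero.1 h1).resolve_left (hx0 _)
  have h1 := hle p.1 p.2 hpk
  rw [hzp, map_zero] at h1
  have h2 : algebraMap N E (g' (p.1, p.2)) = 0 := w.zero_iff.1 (le_antisymm h1 zero_le)
  simpa [g', hp] using h2

/-- A finite extension `E` of a valued field `N` contains a linearly independent family of `e * f`
elements whose linear combinations approximate all elements of `E`. -/
theorem exists_linearIndependent_approx [FiniteDimensional N E] :
    ∃ b : Fin (ramificationIndex v w * residueDegree v w) → E, LinearIndependent N b ∧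
      ∀ z : E, z ≠ 0 → ∃ c : Fin (ramificationIndex v w * residueDegree v w) → N,
        w (z - ∑ i, c i • b i) < w z := by
  set H := valueGrp (w.comap (algebraMap N E))
  set G := valueGrp w
  have hHm : ∀ γ, γ ∈ H ↔ ∃ c : N, w (algebraMap N E c) = γ := fun _ ↦ mem_valueGrp
  let Q := G ⧸ H.subgroupOf G
  have hxex : ∀ q : Q, ∃ x : E, w x = (q.out : Γ'ˣ) := fun q ↦ mem_valueGrp.1 q.out.2
  choose x hx using hxex
  let r := Module.Free.chooseBasis (Residue v) (Residue w)
  choose y hy using fun k ↦ residue_surjective (R := w.valuationSubring) (r k)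
  have hylin : LinearIndependent (Residue v) (fun k ↦ residue _ (y k)) := by
    simpa only [hy] using r.linearIndependent
  have hx0 : ∀ q, x q ≠ 0 := fun q ↦ by
    rw [← w.ne_zero_iff, hx]
    exact Units.ne_zero _
  have hxne : ∀ q q', q ≠ q' → ∀ c : N, w (x q) ≠ w (algebraMap N E c) * w (x q') := by
    intro q q' hne c heq
    apply hne
    rw [← q.out_eq', ← q'.out_eq']
    refine QuotientGroup.eq.2 ?_
    rw [Subgroup.mem_subgroupOf, hHm]
    refine ⟨c⁻¹, ?_⟩
    rw [hx, hx] at heq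
    have hc0 : w (algebraMap N E c) ≠ 0 := by
      rintro h0
      rw [h0, zero_mul] at heq
      exact Units.ne_zero _ heq
    simp only [map_inv₀, Subgroup.coe_mul, Subgroup.coe_inv, Units.val_mul,
      Units.val_inv_eq_inv_val]
    rw [heq]
    field_simp
  have hli := linearIndependent_mul_of_valueGrp_of_residue v w hx0 hxne hylin
  -- Finiteness excludes the default value $0$ of index and rank, so $ef$ really counts these
  -- products.
  have hfin : Finite (Q × Module.Free.ChooseBasisIndex (Residue v) (Residue w)) := hli.finite
  have hcard : Nat.card (Q × Module.Free.ChooseBasisIndex (Residue v) (Residue w)) =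
      ramificationIndex v w * residueDegree v w := by
    rw [Nat.card_prod, ramificationIndex, residueDegree, Module.finrank_eq_nat_card_basis r]
    rfl
  let e := (Finite.equivFinOfCardEq hcard)
  refine ⟨fun i ↦ x (e.symm i).1 * y (e.symm i).2, hli.comp _ e.symm.injective, fun z hz ↦ ?_⟩
  suffices h : ∃ c : Q × Module.Free.ChooseBasisIndex (Residue v) (Residue w) → N,
      ∃ s : Finset (Q × Module.Free.ChooseBasisIndex (Residue v) (Residue w)),
      w (z - ∑ p ∈ s, c p • (x p.1 * (y p.2 : E))) < w z by
    classical
    obtain ⟨c, s, hc⟩ := h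
    refine ⟨fun i ↦ if e.symm i ∈ s then c (e.symm i) else 0, ?_⟩
    convert hc using 3
    let _ := Fintype.ofFinite (Q × Module.Free.ChooseBasisIndex (Residue v) (Residue w))
    rw [e.symm.sum_comp (fun p ↦ (if p ∈ s then c p else 0) • (x p.1 * (y p.2 : E)))]
    simp [ite_smul]
  have hwz : w z ≠ 0 := w.ne_zero_iff.2 hz
  let γ : G := ⟨Units.mk0 (w z) hwz, mem_valueGrp.2 ⟨z, rfl⟩⟩
  let q : Q := QuotientGroup.mk γ
  have hqγ : (q.out)⁻¹ * γ ∈ H.subgroupOf G := QuotientGroup.eq.1 (QuotientGroup.out_eq' q)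
  rw [Subgroup.mem_subgroupOf, hHm] at hqγ
  obtain ⟨c, hc⟩ := hqγ
  have hc' : w (algebraMap N E c) * w (x q) = w z := by
    rw [hx]
    simp only [Subgroup.coe_mul, Subgroup.coe_inv, Units.val_mul,
      Units.val_inv_eq_inv_val] at hc
    rw [hc, mul_comm, ← mul_assoc, mul_inv_cancel₀ (Units.ne_zero _), one_mul]
    rfl
  have hcx : w (algebraMap N E c * x q) ≠ 0 := by rw [map_mul, hc']; exact hwz
  have hcx0 : algebraMap N E c * x q ≠ 0 := w.ne_zero_iff.1 hcx
  have hu : w (z / (algebraMap N E c * x q)) = 1 := by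
    rw [map_div₀, map_mul, hc', div_self hwz]
  -- The unit left after matching the value of $z$ by $c\,x_q$; the basis expansion of its residue,
  -- lifted to $N$, supplies the other coefficients.
  let u : w.valuationSubring := ⟨z / (algebraMap N E c * x q), hu.le⟩
  have hrep := r.linearCombination_repr (residue _ u)
  choose d hd using fun k ↦ residue_surjective (R := v.valuationSubring) (r.repr (residue _ u) k)
  classical
  let t := (r.repr (residue _ u)).support
  refine ⟨fun p ↦ c * d p.2, t.image (fun k ↦ (q, k)), ?_⟩
  have hlt : w ((u : E) - (∑ k ∈ t, algebraMap v.valuationSubring w.valuationSubring (d k) * y k :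
      w.valuationSubring)) < 1 := by
    rw [← residue_eq_iff, map_sum, ← hrep, Finsupp.linearCombination_apply, Finsupp.sum]
    refine Finset.sum_congr rfl fun k _ ↦ ?_
    rw [map_mul, hy, Algebra.smul_def, ← hd k]
    rfl
  have hz' : z - ∑ p ∈ t.image (fun k ↦ (q, k)), (c * (d p.2 : N)) • (x p.1 * (y p.2 : E)) =
      (algebraMap N E c * x q) * ((u : E) -
        (∑ k ∈ t, algebraMap v.valuationSubring w.valuationSubring (d k) * y k :
          w.valuationSubring)) := by
    rw [Finset.sum_image (by intro a _ b _ h; exact (Prod.ext_iff.1 h).2), mul_sub,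
      AddSubmonoidClass.coe_finsetSum, Finset.mul_sum]
    congr 1
    · simp only [u]
      rw [mul_div_assoc', mul_div_cancel_left₀ _ hcx0]
    · refine Finset.sum_congr rfl fun k _ ↦ ?_
      rw [MulMemClass.coe_mul, Valuation.HasExtension.coe_algebraMap_valuationSubring_eq,
        Algebra.smul_def, map_mul]
      ring
  rw [hz', map_mul, map_mul, hc']
  exact mul_lt_of_lt_one_right (zero_lt_iff.2 hwz) hlt

end Fundamental
end HenselRat

namespace HenselRat
open IsLocalRing

/-! ### Separable elements over relatively separably closed subfields -/

section Separable

/-- If the minimal polynomial had zero derivative, the product rule would make $f'(b)$ vanish. Roots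
found by Hensel's Lemma are simple, which is how their separability is recognized. -/
theorem isSeparable_of_aeval_derivative_ne_zero {N M : Type*} [Field N] [Field M] [Algebra N M]
    {f : Polynomial N} {b : M} (h0 : Polynomial.aeval b f = 0)
    (h1 : Polynomial.aeval b f.derivative ≠ 0) : IsSeparable N b := by
  have hf : f ≠ 0 := by
    rintro rfl
    simp at h1
  have hint : IsIntegral N b := IsAlgebraic.isIntegral ⟨f, hf, h0⟩
  obtain ⟨k, hk⟩ := minpoly.dvd N b h0
  rw [IsSeparable, Polynomial.separable_iff_derivative_ne_zero (minpoly.irreducible hint)]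
  intro hd
  apply h1
  rw [hk, Polynomial.derivative_mul, hd, zero_mul, zero_add, map_mul, minpoly.aeval, zero_mul]

/-- The coefficients of the minimal polynomial over $L$ are polynomials in conjugates of $b$ over
$N$, so they are separable over $N$ and lie in $N$ by hypothesis. -/
theorem natDegree_minpoly_eq_of_isSeparable {N L M : Type*} [Field N] [Field L] [Field M]
    [Algebra N L] [Algebra N M] [Algebra L M] [IsScalarTower N L M]
    (hcl : ∀ x : L, IsSeparable N x → x ∈ (algebraMap N L).range) {b : M} (hb : IsSeparable N b) :
    (minpoly L b).natDegree = (minpoly N b).natDegree := by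
  have hbN : IsIntegral N b := hb.isIntegral
  have hbL : IsIntegral L b := hbN.tower_top
  let Ω := AlgebraicClosure M
  have hdvd : minpoly L b ∣ (minpoly N b).map (algebraMap N L) :=
    minpoly.dvd_map_of_isScalarTower N L b
  let S := separableClosure N Ω
  have hsplit := IsAlgClosed.splits ((minpoly L b).map (algebraMap L Ω))
  have hprod := hsplit.eq_prod_roots_of_monic ((minpoly.monic hbL).map _)
  have hlift : (minpoly L b).map (algebraMap L Ω) ∈ Polynomial.lifts (algebraMap S Ω) := by
    rw [hprod]
    refine multiset_prod_mem _ fun g hg ↦ ?_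
    obtain ⟨r, hr, rfl⟩ := Multiset.mem_map.1 hg
    have hrS : r ∈ S := by
      rw [mem_separableClosure_iff]
      have hr0 : Polynomial.aeval r (minpoly L b) = 0 := by
        have := (Polynomial.mem_roots'.1 hr).2
        rwa [Polynomial.IsRoot, Polynomial.eval_map_algebraMap] at this
      have hr1 : Polynomial.aeval r (minpoly N b) = 0 := by
        obtain ⟨k, hk⟩ := hdvd
        have := congrArg (Polynomial.aeval r) hk
        rwa [map_mul, hr0, zero_mul, Polynomial.aeval_map_algebraMap] at this
      exact Polynomial.Separable.of_dvd hb (minpoly.dvd N r hr1)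
    exact ⟨Polynomial.X - Polynomial.C ⟨r, hrS⟩, by simp⟩
  have hliftN : minpoly L b ∈ Polynomial.lifts (algebraMap N L) := by
    rw [Polynomial.lifts_iff_coeff_lifts]
    intro n
    obtain ⟨s, hs⟩ := (Polynomial.lifts_iff_coeff_lifts _).1 hlift n
    rw [Polynomial.coeff_map] at hs
    have h1 : IsSeparable N (algebraMap L Ω ((minpoly L b).coeff n)) := by
      rw [← hs]
      exact mem_separableClosure_iff.1 s.2
    have h2 : IsSeparable N ((minpoly L b).coeff n) := by
      rw [IsSeparable, ← minpoly.algebraMap_eq (algebraMap L Ω).injective]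
      exact h1
    exact hcl _ h2
  obtain ⟨g, hg, hdeg, hmon⟩ := Polynomial.lifts_and_natDegree_eq_and_monic hliftN
    (minpoly.monic hbL)
  have hroot : Polynomial.aeval b g = 0 := by
    rw [← Polynomial.aeval_map_algebraMap L, hg, minpoly.aeval]
  refine le_antisymm ?_ ?_
  · have := Polynomial.natDegree_le_of_dvd hdvd
      (Polynomial.map_ne_zero (minpoly.ne_zero hbN))
    rwa [Polynomial.natDegree_map] at this
  · rw [← hdeg]
    exact Polynomial.natDegree_le_of_dvd (minpoly.dvd N b hroot) hmon.ne_zero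

end Separable

/-! ### Immediacy over relatively separably closed subfields -/

section Immediate

variable {N E L M : Type*} [Field N] [Field E] [Field L] [Field M] [Algebra N E] [Algebra N L]
  [Algebra N M] [Algebra E M] [Algebra L M] [IsScalarTower N E M] [IsScalarTower N L M]
  {Γ Γ' : Type*} [LinearOrderedCommGroupWithZero Γ] [LinearOrderedCommGroupWithZero Γ']
  {v : Valuation N Γ} {w : Valuation M Γ'}

/-- The value group is divisible by the residue characteristic. -/
def IsResidueCharDivisible (v : Valuation N Γ) : Prop :=
  ∀ p : ℕ, p.Prime → v (p : N) < 1 → ∀ c : N, ∃ d : N, v d ^ p = v c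

theorem val_natCast_le_one (w : Valuation M Γ') (n : ℕ) : w (n : M) ≤ 1 := by
  have : (n : M) ∈ w.integer := natCast_mem _ n
  exact this

theorem val_natCast_eq_one_of_forall_prime (w : Valuation M Γ') {m : ℕ} (hm : m ≠ 0)
    (h : ∀ p, p.Prime → p ∣ m → w (p : M) = 1) : w (m : M) = 1 := by
  induction m using Nat.recOnMul with
  | zero => exact absurd rfl hm
  | one => simp
  | prime p hp => exact h p hp dvd_rfl
  | mul a b ha hb =>
    rw [Nat.cast_mul, map_mul, ha (left_ne_zero_of_mul hm) fun p hp hpa ↦ h p hp (hpa.mul_right b),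
      hb (right_ne_zero_of_mul hm) fun p hp hpb ↦ h p hp (hpb.mul_left a), mul_one]

/-- In an algebraic equation for $z$ over $L$ two nonzero terms have equal value, so a power of $z$
has the value of a quotient of coefficients, which immediacy realizes in $N$. -/
theorem exists_pow_val_eq_of_isAlgebraic {z : M} (hz : z ≠ 0) (halg : IsAlgebraic L z)
    (happ : ApproxBy N (w.comap (algebraMap L M))) :
    ∃ m : ℕ, m ≠ 0 ∧ ∃ c : N, w (algebraMap N M c) = w z ^ m := by
  obtain ⟨f, hf0, hf⟩ := halg
  have hwz : w z ≠ 0 := w.ne_zero_iff.2 hz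
  by_contra! hcon
  rw [Polynomial.aeval_eq_sum_range] at hf
  have key : ∀ i j : ℕ, i < j → f.coeff i ≠ 0 →
      w (f.coeff i • z ^ i) ≠ w (f.coeff j • z ^ j) := by
    intro i j hij h0 heq
    have hi : w (algebraMap L M (f.coeff i)) ≠ 0 := by simpa using h0
    rw [Algebra.smul_def, Algebra.smul_def, map_mul, map_mul, map_pow, map_pow] at heq
    have hj : w (algebraMap L M (f.coeff j)) ≠ 0 := by
      intro h
      rw [h, zero_mul] at heq
      exact mul_ne_zero hi (pow_ne_zero _ hwz) heq
    obtain ⟨c, hc⟩ := happ.exists_val_eq (f.coeff i / f.coeff j)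
    refine hcon (j - i) (by omega) c ?_
    rw [Valuation.comap_apply, Valuation.comap_apply, ← IsScalarTower.algebraMap_apply, map_div₀,
      map_div₀] at hc
    rw [hc, div_eq_iff hj]
    have : j = (j - i) + i := by omega
    rw [this, pow_add, ← mul_assoc] at heq
    have h3 := mul_right_cancel₀ (pow_ne_zero _ hwz) heq
    rw [h3, mul_comm, ← this]
  have hall : ∀ i ∈ Finset.range (f.natDegree + 1), w (f.coeff i • z ^ i) ≤ 0 := by
    intro i hi
    rw [← w.map_zero, ← hf]
    refine val_le_val_sum_of_pairwise_ne (f := fun i ↦ f.coeff i • z ^ i) ?_ hi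
    intro i _ j _ hij h0 heq
    rcases lt_or_gt_of_ne hij with h | h
    · refine key i j h ?_ heq
      intro hc
      simp [hc] at h0
    · refine key j i h ?_ heq.symm
      intro hc
      rw [heq] at h0
      simp [hc] at h0
  have := hall f.natDegree (by simp)
  rw [le_zero_iff, w.zero_iff, smul_eq_zero] at this
  rcases this with h | h
  · exact hf0 (Polynomial.leadingCoeff_eq_zero.1 h)
  · exact pow_ne_zero _ hz h

/-- Take the least exponent. A prime factor $p$ of it with $w(p)<1$ could be cancelled, because
values in $N$ are $p$-divisible and $p$-th roots of values are unique. -/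
theorem exists_pow_val_eq_of_isResidueCharDivisible [v.HasExtension w] {z : M}
    (hdiv : IsResidueCharDivisible v)
    (h : ∃ m : ℕ, m ≠ 0 ∧ ∃ c : N, w (algebraMap N M c) = w z ^ m) :
    ∃ m : ℕ, m ≠ 0 ∧ w (m : M) = 1 ∧ ∃ c : N, w (algebraMap N M c) = w z ^ m := by
  classical
  obtain ⟨hm0, c, hc⟩ := Nat.find_spec h
  refine ⟨Nat.find h, hm0, val_natCast_eq_one_of_forall_prime w hm0 fun p hp hpm ↦ ?_, c, hc⟩
  by_contra hne
  have hlt : w (p : M) < 1 := lt_of_le_of_ne (val_natCast_le_one w p) hne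
  have hlt' : v (p : N) < 1 := by
    rw [← Valuation.HasExtension.val_map_lt_one_iff v w]
    simpa using hlt
  obtain ⟨d, hd⟩ := hdiv p hp hlt' c
  obtain ⟨k, hk⟩ := hpm
  have hk0 : k ≠ 0 := by
    rintro rfl
    exact hm0 hk
  refine Nat.find_min h (m := k) ?_ ⟨hk0, d, ?_⟩
  · rw [hk]
    exact lt_mul_of_one_lt_left (Nat.pos_of_ne_zero hk0) hp.one_lt
  · rw [← map_pow, ← Valuation.HasExtension.val_map_eq_iff v w, map_pow, map_pow, hc, hk,
      mul_comm, pow_mul] at hd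
    exact (pow_left_inj₀ zero_le zero_le hp.ne_zero).1 hd

/-- Divide an equation for $z$ over $L$ by a coefficient of largest value and replace the
coefficients by elements of $N$ with the same residues. The reduced equation is nonzero, as one
coefficient becomes $1$. -/
theorem isAlgebraic_residue [v.HasExtension w] [Algebra.IsAlgebraic L M]
    (happ : ApproxBy N (w.comap (algebraMap L M))) (ζ : Residue w) :
    IsAlgebraic (Residue v) ζ := by
  obtain ⟨z, rfl⟩ := residue_surjective ζ
  obtain ⟨f, hf0, hf⟩ := Algebra.IsAlgebraic.isAlgebraic (R := L) (z : M)
  obtain ⟨m, hm, hmax⟩ := (Finset.range (f.natDegree + 1)).exists_max_image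
    (fun i ↦ w (algebraMap L M (f.coeff i))) ⟨0, by simp⟩
  have hfm : w (algebraMap L M (f.coeff m)) ≠ 0 := by
    intro h0
    have := hmax f.natDegree (by simp)
    rw [h0, le_zero_iff, w.zero_iff, map_eq_zero] at this
    exact hf0 (Polynomial.leadingCoeff_eq_zero.1 this)
  have hcoeff : ∀ i ∈ Finset.range (f.natDegree + 1),
      w (algebraMap L M (f.coeff i / f.coeff m)) ≤ 1 := by
    intro i hi
    rw [map_div₀, map_div₀, div_le_one₀ (zero_lt_iff.2 hfm)]
    exact hmax i hi
  have hex : ∀ i, ∃ c : v.valuationSubring, i ∈ Finset.range (f.natDegree + 1) →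
      w (algebraMap L M (f.coeff i / f.coeff m) - algebraMap N M c) < 1 := by
    intro i
    by_cases hi : i ∈ Finset.range (f.natDegree + 1)
    · obtain ⟨c, hc⟩ := happ.exists_sub_lt_one (x := f.coeff i / f.coeff m) (hcoeff i hi)
      rw [Valuation.comap_apply, map_sub, ← IsScalarTower.algebraMap_apply] at hc
      have hc1 : v c ≤ 1 := by
        rw [← Valuation.HasExtension.val_map_le_one_iff v w]
        have e : algebraMap N M c = algebraMap L M (f.coeff i / f.coeff m) -
          (algebraMap L M (f.coeff i / f.coeff m) - algebraMap N M c) := by ring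
        rw [e]
        exact Valuation.map_sub_le _ (hcoeff i hi) hc.le
      exact ⟨⟨c, hc1⟩, fun _ ↦ hc⟩
    · exact ⟨0, fun h ↦ absurd h hi⟩
  choose c hc using hex
  let g : Polynomial (Residue v) := ∑ i ∈ Finset.range (f.natDegree + 1),
    Polynomial.monomial i (residue _ (c i))
  refine ⟨g, ?_, ?_⟩
  · intro hg
    have h1 := congrArg (fun q ↦ Polynomial.coeff q m) hg
    simp only [g, Polynomial.finsetSum_coeff, Polynomial.coeff_monomial, Finset.sum_ite_eq',
      if_pos hm, Polynomial.coeff_zero] at h1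
    rw [residue_eq_zero_iff, Valuation.mem_maximalIdeal_iff,
      ← Valuation.HasExtension.val_map_lt_one_iff v w] at h1
    have h2 := hc m hm
    rw [div_self (by simpa using hfm), map_one, Valuation.map_sub_swap] at h2
    have h3 : (1 : M) = algebraMap N M (c m) - (algebraMap N M (c m) - 1) := by ring
    have h4 := Valuation.map_sub_lt w h1 h2
    rw [← h3, map_one] at h4
    exact lt_irrefl _ h4
  · have hsum : Polynomial.aeval (residue w.valuationSubring z) g = residue _
        (∑ i ∈ Finset.range (f.natDegree + 1),
          algebraMap v.valuationSubring w.valuationSubring (c i) * z ^ i) := by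
      rw [map_sum, map_sum]
      refine Finset.sum_congr rfl fun i _ ↦ ?_
      rw [Polynomial.aeval_monomial, map_mul, map_pow]
      rfl
    rw [hsum, residue_eq_zero_iff, Valuation.mem_maximalIdeal_iff, AddSubmonoidClass.coe_finsetSum]
    have hz0 : ∑ i ∈ Finset.range (f.natDegree + 1),
        algebraMap L M (f.coeff i / f.coeff m) * (z : M) ^ i = 0 := by
      rw [Polynomial.aeval_eq_sum_range] at hf
      rw [← zero_div (algebraMap L M (f.coeff m)), ← hf, Finset.sum_div]
      refine Finset.sum_congr rfl fun i _ ↦ ?_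
      rw [Algebra.smul_def, map_div₀]
      ring
    have hdiff : ∑ i ∈ Finset.range (f.natDegree + 1),
        ((algebraMap v.valuationSubring w.valuationSubring (c i) * z ^ i : w.valuationSubring) : M) =
        - ∑ i ∈ Finset.range (f.natDegree + 1),
        (algebraMap L M (f.coeff i / f.coeff m) - algebraMap N M (c i)) * (z : M) ^ i := by
      rw [← sub_eq_zero, sub_neg_eq_add, ← Finset.sum_add_distrib, ← hz0]
      refine Finset.sum_congr rfl fun i _ ↦ ?_
      rw [MulMemClass.coe_mul, Valuation.HasExtension.coe_algebraMap_valuationSubring_eq,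
        SubmonoidClass.coe_pow]
      ring
    rw [hdiff, Valuation.map_neg]
    refine Valuation.map_sum_lt w one_ne_zero fun i hi ↦ ?_
    rw [map_mul, map_pow]
    exact mul_lt_one_of_lt_of_le (hc i hi) (pow_le_one₀ zero_le z.2)

/-- Lift the minimal polynomial of the residue to the valuation ring of $N$. Separability makes the
residue a simple root, so Hensel's Lemma applies in $M$, and the resulting root is simple over $N$.
-/
theorem exists_isSeparable_root_of_residue [v.HasExtension w] (hw : IsHenselian w)
    {z : w.valuationSubring} (hz : IsSeparable (Residue v) (residue w.valuationSubring z)) :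
    ∃ b : M, IsSeparable N b ∧ w ((z : M) - b) < 1 := by
  set ζ := residue w.valuationSubring z with hζ
  have hint : IsIntegral (Residue v) ζ := hz.isIntegral
  have hl : minpoly (Residue v) ζ ∈ Polynomial.lifts (residue v.valuationSubring) := by
    rw [Polynomial.lifts_iff_coeff_lifts]
    intro n
    exact residue_surjective _
  obtain ⟨g, hg, -, hmon⟩ := Polynomial.lifts_and_natDegree_eq_and_monic hl (minpoly.monic hint)
  let φ := algebraMap v.valuationSubring w.valuationSubring
  have hcomp : (residue w.valuationSubring).comp φ =
      (algebraMap (Residue v) (Residue w)).comp (residue v.valuationSubring) := rfl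
  have hres : ∀ q : Polynomial v.valuationSubring, residue w.valuationSubring ((q.map φ).eval z) =
      Polynomial.aeval ζ (q.map (residue v.valuationSubring)) := by
    intro q
    rw [Polynomial.eval_map, Polynomial.hom_eval₂, hcomp, Polynomial.aeval_def,
      Polynomial.eval₂_map]
  have hw' : HenselianLocalRing w.valuationSubring := hw
  obtain ⟨b, hb, hbz⟩ := hw'.is_henselian (g.map φ) (hmon.map φ) z (by
    rw [← residue_eq_zero_iff, hres, hg, minpoly.aeval]) (by
    rw [← residue_ne_zero_iff_isUnit, Polynomial.derivative_map, hres, ← Polynomial.derivative_map,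
      hg]
    exact hz.aeval_derivative_ne_zero (minpoly.aeval _ _))
  have hbz' : w ((z : M) - b) < 1 := by
    rw [Valuation.map_sub_swap]
    exact w.mem_maximalIdeal_iff.1 hbz
  refine ⟨b, ?_, hbz'⟩
  have hbres : residue w.valuationSubring b = ζ := by
    rw [hζ, eq_comm, residue_eq_iff]
    exact hbz'
  have hcoe : ∀ q : Polynomial v.valuationSubring,
      Polynomial.aeval (b : M) (q.map (algebraMap v.valuationSubring N)) =
      ((q.map φ).eval b : w.valuationSubring) := by
    intro q
    rw [Polynomial.eval_map, Polynomial.aeval_def, Polynomial.eval₂_map]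
    exact (Polynomial.hom_eval₂ q φ w.valuationSubring.subtype b).symm
  refine isSeparable_of_aeval_derivative_ne_zero
    (f := g.map (algebraMap v.valuationSubring N)) ?_ ?_
  · rw [hcoe, show (g.map φ).eval b = 0 from hb]
    rfl
  · rw [Polynomial.derivative_map, hcoe]
    intro h0
    have h1 : (g.derivative.map φ).eval b = 0 := Subtype.ext h0
    have h2 := congrArg (residue w.valuationSubring) h1
    rw [Polynomial.eval_map, Polynomial.hom_eval₂, hcomp, hbres, map_zero, ← Polynomial.eval₂_map,
      ← Polynomial.derivative_map, hg] at h2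
    exact hz.aeval_derivative_ne_zero (minpoly.aeval _ _) h2

/-- If a henselian field `M` is algebraic over an immediate extension of `N`, then it is an immediate
extension of every separable-algebraic extension of `N` which is relatively separably closed
in `M`. -/
theorem approxBy_of_isHenselian [v.HasExtension w] [Algebra.IsAlgebraic L M]
    [Algebra.IsSeparable N E] [PerfectField (Residue v)] (hw : IsHenselian w)
    (happ : ApproxBy N (w.comap (algebraMap L M))) (hdiv : IsResidueCharDivisible v)
    (hcl : ∀ x : M, IsSeparable N x → x ∈ (algebraMap E M).range) : ApproxBy E w := by
  have hres : ∀ z : M, w z ≤ 1 → ∃ e : E, w (z - algebraMap E M e) < 1 := by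
    intro z hz
    have hsep : IsSeparable (Residue v) (residue w.valuationSubring ⟨z, hz⟩) :=
      PerfectField.separable_of_irreducible
        (minpoly.irreducible (isAlgebraic_residue happ _).isIntegral)
    obtain ⟨b, hb, hbz⟩ := exists_isSeparable_root_of_residue hw hsep
    obtain ⟨e, rfl⟩ := hcl b hb
    exact ⟨e, hbz⟩
  intro z hz
  have hwz : w z ≠ 0 := w.ne_zero_iff.2 hz
  -- The aim is $s$ with $w(s-1)<1$ such that $(z/s)^m\in E$. Here $m$ is a unit, so $1$-units have
  -- $m$-th roots by Hensel's Lemma and $z/s$ is separable over $E$, hence in $E$.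
  obtain ⟨m, hm0, hm1, c, hc⟩ := exists_pow_val_eq_of_isResidueCharDivisible hdiv
    (exists_pow_val_eq_of_isAlgebraic hz (Algebra.IsAlgebraic.isAlgebraic (R := L) z) happ)
  have hc0 : algebraMap N M c ≠ 0 := by
    rw [← w.ne_zero_iff, hc]
    exact pow_ne_zero _ hwz
  have hu : w (z ^ m / algebraMap N M c) = 1 := by
    rw [map_div₀, map_pow, hc, div_self (pow_ne_zero _ hwz)]
  -- Dividing by $e$ turns the unit $z^m/c$ into the $1$-unit $t$.
  obtain ⟨e, he⟩ := hres _ hu.le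
  have hwe : w (algebraMap E M e) = 1 := by
    rw [← hu]
    exact val_eq_of_sub_lt (by rwa [hu])
  have he0 : algebraMap E M e ≠ 0 := by
    rw [← w.ne_zero_iff, hwe]
    exact one_ne_zero
  let t : M := z ^ m / algebraMap N M c / algebraMap E M e
  have ht : w t = 1 := by rw [map_div₀, hu, hwe, div_one]
  have ht1 : w (1 - t) < 1 := by
    have : 1 - t = -((z ^ m / algebraMap N M c - algebraMap E M e) / algebraMap E M e) := by
      simp only [t]
      rw [sub_div, div_self he0]
      ring
    rwa [this, Valuation.map_neg, map_div₀, hwe, div_one]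
  have hw' : HenselianLocalRing w.valuationSubring := hw
  obtain ⟨s, hs, hs1⟩ := hw'.is_henselian
    (Polynomial.X ^ m - Polynomial.C (⟨t, ht.le⟩ : w.valuationSubring))
    (Polynomial.monic_X_pow_sub_C _ hm0) 1 (by
      rw [Polynomial.eval_sub, Polynomial.eval_pow, Polynomial.eval_X, one_pow, Polynomial.eval_C,
        Valuation.mem_maximalIdeal_iff]
      exact ht1) (by
      rw [Polynomial.derivative_sub, Polynomial.derivative_C, Polynomial.derivative_X_pow, sub_zero,
        Polynomial.eval_mul, Polynomial.eval_pow, Polynomial.eval_X, one_pow, mul_one,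
        Polynomial.eval_C]
      refine (Valuation.integer.integers w).isUnit_of_one' ?_
      exact hm1)
  have hs1' : w ((s : M) - 1) < 1 := w.mem_maximalIdeal_iff.1 hs1
  have hst : (s : M) ^ m = t := by
    have h1 : s ^ m = ⟨t, ht.le⟩ := by
      rw [Polynomial.IsRoot, Polynomial.eval_sub, Polynomial.eval_pow, Polynomial.eval_X,
        Polynomial.eval_C, sub_eq_zero] at hs
      exact hs
    exact congrArg Subtype.val h1
  have hs0 : (s : M) ≠ 0 := by
    intro h0
    rw [h0, zero_pow hm0] at hst
    rw [← hst, map_zero] at ht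
    exact zero_ne_one ht
  have hws : w (s : M) = 1 := by
    have := Valuation.map_sub_swap w (s : M) 1 ▸ hs1'
    rw [← map_one w] at this
    exact (val_eq_of_sub_lt this).trans (map_one w)
  have hym : (z / s) ^ m = algebraMap E M (algebraMap N E c * e) := by
    rw [div_pow, hst, map_mul, ← IsScalarTower.algebraMap_apply]
    simp only [t]
    field_simp
  have hmM : (m : M) ≠ 0 := by
    rw [← w.ne_zero_iff, hm1]
    exact one_ne_zero
  have hsepE : IsSeparable E (z / (s : M)) := by
    refine isSeparable_of_aeval_derivative_ne_zero
      (f := Polynomial.X ^ m - Polynomial.C (algebraMap N E c * e)) ?_ ?_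
    · simp [hym]
    · simp [Polynomial.derivative_X_pow, hmM, hz, hs0]
  have hsepN : IsSeparable N (z / (s : M)) := hsepE.of_algebra_isSeparable_of_isSeparable N
  obtain ⟨y, hy⟩ := hcl _ hsepN
  refine ⟨y, ?_⟩
  have : z - algebraMap E M y = z / s * ((s : M) - 1) := by
    rw [show algebraMap E M y = z / s from hy]
    field_simp
  rw [this, map_mul, map_div₀, hws, div_one]
  exact mul_lt_of_lt_one_right (zero_lt_iff.2 hwz) hs1'

end Immediate
end HenselRat

namespace HenselRat
open IsLocalRing IntermediateField

/-! ### Composita of full degree -/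

section Compositum

/-- Extend $x$ to an $N$-basis of $E$. It spans $M$ over $L$ and has $[M:L]$ elements, so it is
$L$-independent. -/
theorem linearIndependent_algebraMap_of_span_eq_top {N E L M ι : Type*} [Field N] [Field E]
    [Field L] [Field M] [Algebra N E] [Algebra N L] [Algebra N M] [Algebra E M] [Algebra L M]
    [IsScalarTower N E M] [IsScalarTower N L M] [FiniteDimensional N E]
    (hspan : Submodule.span L (Set.range (algebraMap E M)) = ⊤)
    (hrank : Module.finrank L M = Module.finrank N E) {x : ι → E} (hx : LinearIndependent N x) :
    LinearIndependent L (fun i ↦ algebraMap E M (x i)) := by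
  let b := Module.Basis.extend hx.linearIndepOn_id
  let _ := Module.Basis.fintypeIndexOfRankLtAleph0 b (Module.rank_lt_aleph0 N E)
  have hb : LinearIndependent L (fun i ↦ algebraMap E M (b i)) := by
    refine linearIndependent_of_top_le_span_of_card_eq_finrank ?_ ?_
    · rw [← hspan, Submodule.span_le]
      rintro _ ⟨e, rfl⟩
      rw [← b.sum_repr e, map_sum]
      refine Submodule.sum_mem _ fun i _ ↦ ?_
      rw [Algebra.smul_def, map_mul, ← IsScalarTower.algebraMap_apply,
        IsScalarTower.algebraMap_apply N L M, ← Algebra.smul_def]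
      exact Submodule.smul_mem _ _ (Submodule.subset_span ⟨i, rfl⟩)
    · rw [hrank, Module.finrank_eq_card_basis b]
  have hmem : ∀ i, x i ∈ hx.linearIndepOn_id.extend (Set.subset_univ _) := fun i ↦
    Module.Basis.subset_extend _ ⟨i, rfl⟩
  have hxb : ∀ i, x i = b ⟨x i, hmem i⟩ := fun i ↦
    (Module.Basis.extend_apply_self hx.linearIndepOn_id ⟨x i, hmem i⟩).symm
  rw [funext fun i ↦ congrArg (algebraMap E M) (hxb i)]
  exact hb.comp (fun i ↦ (⟨x i, hmem i⟩ : hx.linearIndepOn_id.extend (Set.subset_univ _)))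
    fun i j hij ↦ hx.injective (congrArg Subtype.val hij)

/-- A finite separable extension `E` of `N` has a compositum of full degree with every extension
`L` in which `N` is relatively separably closed. -/
theorem exists_compositum {N E : Type*} {L : Type u} [Field N] [Field E] [Field L] [Algebra N E]
    [Algebra N L] [FiniteDimensional N E] [Algebra.IsSeparable N E]
    (hcl : ∀ x : L, IsSeparable N x → x ∈ (algebraMap N L).range) :
    ∃ (M : Type u) (_ : Field M) (_ : Algebra N M) (_ : Algebra E M) (_ : Algebra L M)
      (_ : IsScalarTower N E M) (_ : IsScalarTower N L M), FiniteDimensional L M ∧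
      Module.finrank L M = Module.finrank N E ∧
      Submodule.span L (Set.range (algebraMap E M)) = ⊤ ∧
      ∀ x : M, IsSeparable N x → x ∈ (algebraMap E M).range := by
  obtain ⟨α, hα⟩ := Field.exists_primitive_element N E
  let Ω := AlgebraicClosure L
  let σ : E →ₐ[N] Ω := IsAlgClosed.lift
  let M : IntermediateField L Ω := L⟮σ α⟯
  have hαint : IsIntegral N α := Algebra.IsIntegral.isIntegral α
  have hαsep : IsSeparable N (σ α) := by
    rw [IsSeparable, minpoly.algHom_eq σ σ.injective]
    exact Algebra.IsSeparable.isSeparable N α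
  have hβ : IsIntegral L (σ α) := hαsep.isIntegral.tower_top
  have hmem : ∀ e : E, σ e ∈ M := by
    have hle : N⟮α⟯ ≤ (M.restrictScalars N).comap σ := by
      rw [adjoin_simple_le_iff]
      exact mem_adjoin_simple_self L (σ α)
    intro e
    have : e ∈ N⟮α⟯ := hα ▸ mem_top
    exact hle this
  let τ : E →+* M := (σ : E →+* Ω).codRestrict M hmem
  let _ : Algebra E M := τ.toAlgebra
  have hτ : ∀ e, ((algebraMap E M e : M) : Ω) = σ e := fun _ ↦ rfl
  have t1 : IsScalarTower N E M := .of_algebraMap_eq fun c ↦ Subtype.ext (by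
    rw [hτ, AlgHom.commutes]
    rfl)
  have hfin : FiniteDimensional L M := adjoin.finiteDimensional hβ
  have hrank : Module.finrank L M = Module.finrank N E := by
    rw [adjoin.finrank hβ, natDegree_minpoly_eq_of_isSeparable hcl hαsep,
      minpoly.algHom_eq σ σ.injective, ← adjoin.finrank hαint, hα, finrank_top']
  refine ⟨M, inferInstance, inferInstance, inferInstance, inferInstance, t1, inferInstance, hfin,
    hrank, ?_, ?_⟩
  · rw [eq_top_iff, ← (adjoin.powerBasis hβ).basis.span_eq, Submodule.span_le]
    rintro _ ⟨i, rfl⟩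
    refine Submodule.subset_span ⟨α ^ (i : ℕ), ?_⟩
    rw [PowerBasis.coe_basis, adjoin.powerBasis_gen]
    ext
    rw [hτ, map_pow]
    rfl
  · intro x hx
    let E₁ : IntermediateField N M := (IsScalarTower.toAlgHom N E M).fieldRange
    have : Algebra.IsSeparable N N⟮x⟯ := (isSeparable_adjoin_simple_iff_isSeparable N M).2 hx
    have : FiniteDimensional N N⟮x⟯ := adjoin.finiteDimensional hx.isIntegral
    let e₁ : E ≃ₐ[N] E₁ := AlgEquiv.ofInjectiveField (IsScalarTower.toAlgHom N E M)
    have : Algebra.IsSeparable N E₁ := AlgEquiv.Algebra.isSeparable e₁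
    have : FiniteDimensional N E₁ := e₁.toLinearEquiv.finiteDimensional
    -- A primitive element of $E(x)$ has the same degree over $N$ as over $L$, hence at most
    -- $[M:L]=[E:N]$; so $E(x)=E$.
    let E₂ := E₁ ⊔ N⟮x⟯
    obtain ⟨γ, hγ⟩ := Field.exists_primitive_element N E₂
    have hγm : minpoly N (γ : M) = minpoly N γ :=
      minpoly.algebraMap_eq (algebraMap E₂ M).injective γ
    have hγsep : IsSeparable N (γ : M) := by
      rw [IsSeparable, hγm]
      exact Algebra.IsSeparable.isSeparable N γ
    have hle : Module.finrank N E₂ ≤ Module.finrank N E₁ := by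
      rw [← e₁.toLinearEquiv.finrank_eq, ← hrank, ← finrank_top', ← hγ,
        adjoin.finrank (Algebra.IsIntegral.isIntegral γ), ← hγm,
        ← natDegree_minpoly_eq_of_isSeparable hcl hγsep]
      exact minpoly.natDegree_le _
    have heq : E₁ = E₂ := eq_of_le_of_finrank_le le_sup_left hle
    have hx1 : x ∈ E₁ := by
      rw [heq]
      exact (le_sup_right : N⟮x⟯ ≤ E₂) (mem_adjoin_simple_self N x)
    exact hx1

end Compositum

/-! ### Defectlessness and separable tameness -/

section Defectless

variable {N L E : Type u} [Field N] [Field L] [Field E] [Algebra N L] [Algebra N E]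
  {Γ Γ' : Type*} [LinearOrderedCommGroupWithZero Γ] [LinearOrderedCommGroupWithZero Γ']

/-- If `N` is relatively separably closed in a spherically complete immediate extension, has
perfect residue field and a value group divisible by the residue characteristic, then every finite
separable extension is defectless. -/
theorem finrank_eq_of_sphericallyComplete {v : Valuation N Γ} {A : ValuationSubring L}
    [v.HasExtension A.valuation] (happ : ApproxBy N A.valuation)
    (hsc : ∀ {Δ : Type u} [LinearOrderedCommGroupWithZero Δ] (w : Valuation L Δ),
        A.valuation.IsEquiv w → SphericallyCompleteOn w Set.univ)
    (hcl : ∀ x : L, IsSeparable N x → x ∈ (algebraMap N L).range)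
    (hdiv : IsResidueCharDivisible v) [PerfectField (Residue v)]
    [FiniteDimensional N E] [Algebra.IsSeparable N E] (w : Valuation E Γ') [v.HasExtension w] :
    Module.finrank N E = ramificationIndex v w * residueDegree v w := by
  obtain ⟨M, _, _, _, _, _, _, _, hrank, hspan, hclM⟩ := exists_compositum (E := E) hcl
  obtain ⟨B, hBE, hBL⟩ := exists_common_extension (M := M) v w A.valuation
    ((isImmediate_iff_approxBy _ _).2 happ)
    (fun x hx ↦ linearIndependent_algebraMap_of_span_eq_top hspan hrank hx)
  have hBN : v.HasExtension B.valuation := hasExtension_trans w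
  have hscL := hsc (B.valuation.comap (algebraMap L M)) hBL.1
  have hens : IsHenselian B.valuation := hscL.of_finiteDimensional.isHenselian
  have happE : ApproxBy E B.valuation :=
    approxBy_of_isHenselian (L := L) hens (happ.isEquiv hBL.1) hdiv hclM
  obtain ⟨b, hb, hbapp⟩ := exists_linearIndependent_approx v w
  refine le_antisymm ?_ ?_
  · have htop : Submodule.span L (Set.range fun i ↦ algebraMap E M (b i)) = ⊤ := by
      refine hscL.eq_top_of_approx (Submodule.fg_span (Set.finite_range _)) fun z hz ↦ ?_
      obtain ⟨e, he⟩ := happE z hz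
      have hez := val_eq_of_sub_lt he
      have he0 : e ≠ 0 := by
        rintro rfl
        simp at he
      obtain ⟨c, hc⟩ := hbapp e he0
      rw [← Valuation.HasExtension.val_map_lt_iff w B.valuation, hez, map_sub, map_sum] at hc
      refine ⟨∑ i, algebraMap E M (c i • b i), Submodule.sum_mem _ fun i _ ↦ ?_, ?_⟩
      · rw [Algebra.smul_def, map_mul, ← IsScalarTower.algebraMap_apply,
          IsScalarTower.algebraMap_apply N L M, ← Algebra.smul_def]
        exact Submodule.smul_mem _ _ (Submodule.subset_span ⟨i, rfl⟩)
      · have e1 : z - ∑ i, algebraMap E M (c i • b i) = (z - algebraMap E M e) +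
            (algebraMap E M e - ∑ i, algebraMap E M (c i • b i)) := by ring
        rw [e1]
        exact Valuation.map_add_lt _ he hc
    rw [← hrank, ← finrank_top, ← htop]
    exact (finrank_range_le_card (R := L) (fun i ↦ algebraMap E M (b i))).trans (by simp)
  · simpa using hb.fintype_card_le_finrank

/-- The root that Hensel's Lemma gives in $L$ is simple, so it is separable over $N$ and lies in
$N$. -/
theorem isHenselian_of_immediate_of_separablyClosed {v : Valuation N Γ} {w : Valuation L Γ'}
    [v.HasExtension w] (hw : IsHenselian w)
    (hcl : ∀ x : L, IsSeparable N x → x ∈ (algebraMap N L).range) : IsHenselian v := by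
  refine { is_henselian := fun f hf a hfa hf' ↦ ?_ }
  let φ := algebraMap v.valuationSubring w.valuationSubring
  have hev : ∀ (q : Polynomial v.valuationSubring) (x : v.valuationSubring),
      (q.map φ).eval (φ x) = φ (q.eval x) := fun q x ↦ by
    rw [Polynomial.eval_map, Polynomial.eval₂_at_apply]
  have hw' : HenselianLocalRing w.valuationSubring := hw
  obtain ⟨b, hb, hba⟩ := hw'.is_henselian (f.map φ) (hf.map φ) (φ a) (by
    rw [hev, Valuation.HasExtension.algebraMap_mem_maximalIdeal_iff]
    exact hfa) (by
    rw [Polynomial.derivative_map, hev]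
    exact hf'.map φ)
  have hcoe : ∀ q : Polynomial v.valuationSubring,
      Polynomial.aeval (b : L) (q.map (algebraMap v.valuationSubring N)) =
      ((q.map φ).eval b : w.valuationSubring) := by
    intro q
    rw [Polynomial.eval_map, Polynomial.aeval_def, Polynomial.eval₂_map]
    exact (Polynomial.hom_eval₂ q φ w.valuationSubring.subtype b).symm
  have hb' : IsUnit ((f.derivative.map φ).eval b) := by
    by_contra hcon
    have h1 := Ideal.mem_of_dvd (maximalIdeal w.valuationSubring)
      (Polynomial.sub_dvd_eval_sub b (φ a) (f.derivative.map φ)) hba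
    have h2 := Ideal.sub_mem _ ((mem_maximalIdeal _).2 hcon) h1
    rw [sub_sub_cancel, hev] at h2
    exact (mem_maximalIdeal _).1 h2 (hf'.map φ)
  have hsep : IsSeparable N (b : L) := by
    refine isSeparable_of_aeval_derivative_ne_zero
      (f := f.map (algebraMap v.valuationSubring N)) ?_ ?_
    · rw [hcoe, show (f.map φ).eval b = 0 from hb]
      rfl
    · rw [Polynomial.derivative_map, hcoe]
      intro h0
      exact hb'.ne_zero (Subtype.ext h0)
  obtain ⟨c, hc⟩ := hcl _ hsep
  have hc1 : v c ≤ 1 := by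
    rw [← Valuation.HasExtension.val_map_le_one_iff v w]
    exact hc ▸ b.2
  have hcb : φ ⟨c, hc1⟩ = b := Subtype.ext hc
  have hinj : Function.Injective φ := fun x y hxy ↦
    Subtype.ext ((algebraMap N L).injective (congrArg Subtype.val hxy))
  refine ⟨⟨c, hc1⟩, hinj ?_, ?_⟩
  · rw [← hev, hcb, map_zero]
    exact hb
  · rw [← Valuation.HasExtension.algebraMap_mem_maximalIdeal_iff v w, map_sub]
    exact hcb ▸ hba

theorem val_ringChar_residue_lt_one {v : Valuation N Γ} : v (ringChar (Residue v) : N) < 1 := by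
  have h1 : residue v.valuationSubring (ringChar (Residue v) : v.valuationSubring) = 0 := by
    rw [map_natCast]
    exact ringChar.Nat.cast_ringChar
  rw [residue_eq_zero_iff, Valuation.mem_maximalIdeal_iff] at h1
  simpa using h1

/-- By Cauchy's theorem $p\mid e$ yields a coset of order $p$. Its $p$-th power has a $p$-th root
among the values of $N$, and roots are unique in an ordered group, so the coset is trivial. -/
theorem not_ringChar_dvd_ramificationIndex {v : Valuation N Γ} (hdiv : IsResidueCharDivisible v)
    (w : Valuation E Γ') [v.HasExtension w] (h0 : ramificationIndex v w ≠ 0) :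
    ¬ ringChar (Residue v) ∣ ramificationIndex v w := by
  intro hdvd
  set p := ringChar (Residue v) with hp
  have hp0 : p ≠ 0 := by
    intro h
    rw [h, zero_dvd_iff] at hdvd
    exact h0 hdvd
  have hprime : p.Prime := (CharP.char_is_prime_or_zero (Residue v) p).resolve_right hp0
  have hvp : v (p : N) < 1 := val_ringChar_residue_lt_one
  let H := valueGrp (w.comap (algebraMap N E))
  let G := valueGrp w
  have hHm : ∀ γ, γ ∈ H ↔ ∃ c : N, w (algebraMap N E c) = γ := fun _ ↦ mem_valueGrp
  have hcard : Nat.card (G ⧸ H.subgroupOf G) = ramificationIndex v w := rfl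
  have : Finite (G ⧸ H.subgroupOf G) := Nat.finite_of_card_ne_zero (hcard ▸ h0)
  have : Fact p.Prime := ⟨hprime⟩
  obtain ⟨q, hq⟩ := exists_prime_orderOf_dvd_card' p (hcard ▸ hdvd)
  obtain ⟨γ, rfl⟩ := QuotientGroup.mk_surjective q
  have h1 : γ ^ p ∈ H.subgroupOf G := by
    rw [← QuotientGroup.eq_one_iff, QuotientGroup.mk_pow, ← hq, pow_orderOf_eq_one]
  rw [Subgroup.mem_subgroupOf, hHm] at h1
  obtain ⟨c, hc⟩ := h1
  obtain ⟨d, hd⟩ := hdiv p hprime hvp c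
  rw [← map_pow, ← Valuation.HasExtension.val_map_eq_iff v w, map_pow, map_pow, hc] at hd
  have h2 : w (algebraMap N E d) = ((γ : Γ'ˣ) : Γ') := by
    refine (pow_left_inj₀ zero_le zero_le hprime.ne_zero).1 (hd.trans ?_)
    simp
  have h3 : γ ∈ H.subgroupOf G := by
    rw [Subgroup.mem_subgroupOf, hHm]
    exact ⟨d, h2⟩
  rw [← QuotientGroup.eq_one_iff] at h3
  rw [h3, orderOf_one] at hq
  exact hprime.one_lt.ne hq

/-- A valued field without proper immediate separable-algebraic extensions, with perfect residue
field and with value group divisible by the residue characteristic is separably tame. -/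
theorem isSeparablyTameField_of_maximal {v : Valuation N Γ}
    (hmax : ∀ (M : Type u) [Field M] [Algebra N M] (Δ : Type u)
      [LinearOrderedCommGroupWithZero Δ] (w' : Valuation M Δ) [v.HasExtension w'],
      Algebra.IsSeparable N M → ApproxBy N w' → Function.Surjective (algebraMap N M))
    (hdiv : IsResidueCharDivisible v) [PerfectField (Residue v)] : IsSeparablyTameField v := by
  obtain ⟨L, _, _, A, hA, happ, hsc⟩ := exists_sphericallyComplete_immediate v
  have hcl : ∀ x : L, IsSeparable N x → x ∈ (algebraMap N L).range := by
    intro x hx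
    have hsep : Algebra.IsSeparable N N⟮x⟯ := (isSeparable_adjoin_simple_iff_isSeparable N L).2 hx
    have : v.HasExtension (A.valuation.comap (algebraMap N⟮x⟯ L)) := inferInstance
    obtain ⟨c, hc⟩ := hmax N⟮x⟯ A.ValueGroup (A.valuation.comap (algebraMap N⟮x⟯ L)) hsep
      happ.tower_bot ⟨x, mem_adjoin_simple_self N x⟩
    exact ⟨c, congrArg Subtype.val hc⟩
  refine ⟨isHenselian_of_immediate_of_separablyClosed
    (hsc A.valuation Valuation.IsEquiv.refl).isHenselian hcl, ?_⟩
  intro F _ _ Γ'' _ w hw hsep E hfin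
  have : Algebra.IsSeparable N E := Algebra.isSeparable_tower_bot_of_isSeparable N E F
  let wE := w.comap (algebraMap E F)
  have hdef := finrank_eq_of_sphericallyComplete happ hsc hcl hdiv wE
  have hpos : 0 < Module.finrank N E := Module.finrank_pos
  refine ⟨not_ringChar_dvd_ramificationIndex hdiv wE ?_, ?_, hdef⟩
  · intro h0
    rw [hdef, h0, zero_mul] at hpos
    exact lt_irrefl _ hpos
  · have : Algebra.IsAlgebraic (Residue v) (Residue wE) := ⟨fun ζ ↦
      isAlgebraic_residue (L := N) (N := N) (M := E) (fun x hx ↦ ⟨x, by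
        simpa [zero_lt_iff] using hx⟩) ζ⟩
    exact Algebra.IsAlgebraic.isSeparable_of_perfectField

end Defectless
end HenselRat

namespace HenselRat
open IsLocalRing IntermediateField Polynomial

/-! ### Value group and residue field of a separably tame field -/

section TameBase

variable {K : Type u} [Field K] {Γ : Type*} [LinearOrderedCommGroupWithZero Γ]
  {v : Valuation K Γ}

/-- In a characteristic $q\neq p$ a Bézout relation $ap+bq=1$ would make $p$ a unit of the valuation
ring. -/
theorem charZero_of_val_natCast_lt_one {p : ℕ} (hp : p.Prime) (hvp : v (p : K) < 1)
    (hp0 : (p : K) ≠ 0) : CharZero K := by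
  obtain ⟨q, hq⟩ := CharP.exists K
  rcases CharP.char_is_prime_or_zero K q with hq' | rfl
  · have hne : p ≠ q := by
      rintro rfl
      exact hp0 (CharP.cast_eq_zero K p)
    have hco : IsCoprime (p : ℤ) (q : ℤ) :=
      Nat.isCoprime_iff_coprime.2 ((Nat.coprime_primes hp hq').2 hne)
    obtain ⟨a, b, hab⟩ := hco
    have h1 : (a : K) * (p : K) = 1 := by
      have := congrArg (Int.cast : ℤ → K) hab
      push_cast at this
      rwa [CharP.cast_eq_zero K q, mul_zero, add_zero] at this
    have h2 : v (a : K) ≤ 1 := (intCast_mem v.integer a : _)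
    have h3 := congrArg v h1
    rw [map_mul, map_one] at h3
    have h4 : v (a : K) * v (p : K) < 1 := (mul_le_of_le_one_left' h2).trans_lt hvp
    exact absurd h3 h4.ne
  · exact CharP.charP_to_charZero K

theorem natCast_residue_eq_zero {p : ℕ} (hvp : v (p : K) < 1) : (p : Residue v) = 0 := by
  rw [← map_natCast (residue v.valuationSubring), residue_eq_zero_iff,
    Valuation.mem_maximalIdeal_iff]
  simpa using hvp

/-- Over a separably tame field, the roots of `X ^ p - η X - c` generate finite tame
extensions. -/
theorem IsSeparablyTameField.exists_root (hv : IsSeparablyTameField v) {p : ℕ} (hp : p.Prime)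
    (hvp : v (p : K) < 1) {η : K} (hη : η ≠ 0) (c : K) :
    ∃ (E : Type u) (_ : Field E) (_ : Algebra K E) (Γ' : Type u)
      (_ : LinearOrderedCommGroupWithZero Γ') (w : Valuation E Γ') (_ : v.HasExtension w) (b : E),
      IsFiniteTame v w ∧ b ^ p = algebraMap K E η * b + algebraMap K E c := by
  let f : K[X] := X ^ p - (C η * X + C c)
  have hlt : (C η * X + C c : K[X]).degree < p :=
    degree_linear_le.trans_lt (by exact_mod_cast hp.one_lt)
  have hdeg : f.degree ≠ 0 := by
    rw [degree_sub_eq_left_of_degree_lt (by rwa [degree_X_pow]), degree_X_pow]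
    exact_mod_cast hp.ne_zero
  obtain ⟨b, hb⟩ := IsAlgClosed.exists_aeval_eq_zero (AlgebraicClosure K) f hdeg
  have hsep : IsSeparable K b := by
    by_cases hp0 : (p : K) = 0
    · refine isSeparable_of_aeval_derivative_ne_zero hb ?_
      have : f.derivative = - C η := by
        simp [f, derivative_X_pow, hp0]
      rw [this]
      simpa using hη
    · have := charZero_of_val_natCast_lt_one hp hvp hp0
      exact Algebra.IsSeparable.isSeparable K b
  have : FiniteDimensional K K⟮b⟯ := adjoin.finiteDimensional hsep.isIntegral
  obtain ⟨A, hA⟩ := exists_hasExtension (L := K⟮b⟯) v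
  have htame := hv.tame K⟮b⟯ A.ValueGroup A.valuation
    ((isSeparable_adjoin_simple_iff_isSeparable K _).2 hsep) ⊤ inferInstance
  refine ⟨(⊤ : IntermediateField K K⟮b⟯), inferInstance, inferInstance, A.ValueGroup, inferInstance,
    _, inferInstance, ⟨⟨b, mem_adjoin_simple_self K b⟩, trivial⟩, htame, ?_⟩
  apply Subtype.ext
  apply Subtype.ext
  simpa [f, sub_eq_zero] using hb

/-- In a finite tame extension, a value whose `p`-th multiple lies in `vK`, with `p` the residue
characteristic, lies in `vK`. -/
theorem IsFiniteTame.exists_val_eq_of_pow {E : Type*} [Field E] [Algebra K E] {Γ' : Type*}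
    [LinearOrderedCommGroupWithZero Γ'] {w : Valuation E Γ'} [v.HasExtension w]
    (h : IsFiniteTame v w) {p : ℕ} (hp : p.Prime) (hvp : v (p : K) < 1)
    {b : E} (hb : b ≠ 0) {c : K} (hc : w b ^ p = w (algebraMap K E c)) :
    ∃ d : K, w (algebraMap K E d) = w b := by
  let H := valueGrp (w.comap (algebraMap K E))
  have hHm : ∀ γ, γ ∈ H ↔ ∃ c : K, w (algebraMap K E c) = γ := fun _ ↦ mem_valueGrp
  let γ : valueGrp w := ⟨Units.mk0 (w b) (w.ne_zero_iff.2 hb), mem_valueGrp.2 ⟨b, rfl⟩⟩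
  let g : valueGrp w ⧸ H.subgroupOf (valueGrp w) := QuotientGroup.mk γ
  have hcard : Nat.card (valueGrp w ⧸ H.subgroupOf (valueGrp w)) = ramificationIndex v w := rfl
  have h1 : g ^ p = 1 := by
    rw [← QuotientGroup.mk_pow, QuotientGroup.eq_one_iff, Subgroup.mem_subgroupOf, hHm]
    exact ⟨c, by simp [γ, hc]⟩
  have h2 : g ^ ramificationIndex v w = 1 := by rw [← hcard, pow_card_eq_one']
  have hco : Nat.Coprime p (ramificationIndex v w) := by
    rw [hp.coprime_iff_not_dvd, ← CharP.ringChar_of_prime_eq_zero hp (natCast_residue_eq_zero hvp)]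
    exact h.not_dvd
  have h3 : g = 1 := by
    have h4 := Nat.dvd_gcd (orderOf_dvd_of_pow_eq_one h1) (orderOf_dvd_of_pow_eq_one h2)
    rw [hco.gcd_eq_one, Nat.dvd_one, orderOf_eq_one_iff] at h4
    exact h4
  rw [QuotientGroup.eq_one_iff, Subgroup.mem_subgroupOf, hHm] at h3
  exact h3

/-- For small $\eta$ a root $b$ of $X^p-\eta X-c$ satisfies $v(b)^p=v(c)$. As the ramification index
is prime to $p$, the value of $b$ already occurs in $K$. -/
theorem IsSeparablyTameField.isResidueCharDivisible (hv : IsSeparablyTameField v)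
    (hnt : ∃ ε : K, ε ≠ 0 ∧ v ε < 1) : IsResidueCharDivisible v := by
  intro p hp hvp c
  rcases eq_or_ne c 0 with rfl | hc0
  · exact ⟨0, by simp [hp.ne_zero]⟩
  have hvc : v c ≠ 0 := v.ne_zero_iff.2 hc0
  -- The bound that makes $b^p$ dominate $\eta b$. Otherwise $v(b)^{p-1}\le v(\eta)$ and $v(c)\le
  -- v(\eta b)$, whence $v(c)^{p-1}\le v(\eta)^p$.
  obtain ⟨η, hη0, hη⟩ : ∃ η : K, η ≠ 0 ∧ v (η ^ p) < v (c ^ (p - 1)) := by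
    rw [map_pow]
    rcases lt_or_ge (v c) 1 with hc | hc
    · refine ⟨c, hc0, ?_⟩
      rw [map_pow]
      exact pow_lt_pow_right_of_lt_one₀ (zero_lt_iff.2 hvc) hc (Nat.sub_lt hp.pos one_pos)
    · obtain ⟨ε, hε0, hε⟩ := hnt
      refine ⟨ε, hε0, ?_⟩
      rw [map_pow]
      exact (pow_lt_one₀ zero_le hε hp.ne_zero).trans_le (one_le_pow₀ hc)
  obtain ⟨E, _, _, Γ', _, w, _, b, htame, hb⟩ := hv.exists_root hp hvp hη0 c
  rw [← Valuation.HasExtension.val_map_lt_iff v w, map_pow, map_pow, map_pow, map_pow] at hη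
  set y := w (algebraMap K E η)
  have hb0 : b ≠ 0 := by
    rintro rfl
    rw [zero_pow hp.ne_zero, mul_zero, zero_add, eq_comm] at hb
    exact hc0 (by simpa using hb)
  have hwb : 0 < w b := zero_lt_iff.2 (w.ne_zero_iff.2 hb0)
  have hpp : p = p - 1 + 1 := (Nat.sub_add_cancel hp.pos).symm
  have hlt : y * w b < w b ^ p := by
    by_contra! hle
    have h1 : w b ^ (p - 1) ≤ y := by
      rw [hpp, pow_succ] at hle
      exact le_of_mul_le_mul_right hle hwb
    have h2 : w (algebraMap K E c) ≤ y * w b := by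
      have : algebraMap K E c = b ^ p - algebraMap K E η * b := by rw [hb]; ring
      rw [this]
      refine (Valuation.map_sub _ _ _).trans (max_le ?_ ?_)
      · rwa [map_pow]
      · rw [map_mul]
    have h3 : w (algebraMap K E c) ^ (p - 1) ≤ y ^ p := by
      refine (pow_le_pow_left₀ zero_le h2 _).trans ?_
      rw [mul_pow]
      conv_rhs => rw [hpp, pow_succ]
      exact mul_le_mul_right h1 _
    exact absurd hη (not_lt.2 h3)
  have hval : w (algebraMap K E c) = w (b ^ p) := by
    refine val_eq_of_sub_lt ?_
    rw [hb, add_sub_cancel_right, ← hb, map_mul, map_pow]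
    exact hlt
  obtain ⟨d, hd⟩ := htame.exists_val_eq_of_pow hp hvp hb0 (c := c) (by rw [hval, map_pow])
  refine ⟨d, ?_⟩
  rw [← map_pow, ← Valuation.HasExtension.val_map_eq_iff v w, map_pow, map_pow, hd, hval, map_pow]

/-- For $v(\varepsilon)<1$ the equation $b^p=\varepsilon b+a$ reduces to $\bar b^{\,p}=\bar a$. The
residue extension is separable by tameness, so the purely inseparable $\bar b$ lies in $Kv$. -/
theorem IsSeparablyTameField.perfectField_residue (hv : IsSeparablyTameField v)
    (hnt : ∃ ε : K, ε ≠ 0 ∧ v ε < 1) : PerfectField (Residue v) := by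
  obtain ⟨p, hp⟩ : ∃ p, p = ringChar (Residue v) := ⟨_, rfl⟩
  have hchar : CharP (Residue v) p := hp ▸ ringChar.charP _
  rcases CharP.char_is_prime_or_zero (Residue v) p with hprime | rfl
  swap
  · have := CharP.charP_to_charZero (Residue v)
    infer_instance
  have hvp : v (p : K) < 1 := hp ▸ val_ringChar_residue_lt_one
  have : Fact p.Prime := ⟨hprime⟩
  have : ExpChar (Residue v) p := .prime hprime
  have : PerfectRing (Residue v) p := by
    refine PerfectRing.ofSurjective _ p fun r ↦ ?_
    obtain ⟨a, rfl⟩ := residue_surjective r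
    obtain ⟨ε, hε0, hε⟩ := hnt
    obtain ⟨E, _, _, Γ', _, w, _, b, htame, hb⟩ := hv.exists_root hprime hvp hε0 a
    rw [← Valuation.HasExtension.val_map_lt_one_iff v w] at hε
    have ha : w (algebraMap K E a) ≤ 1 := (Valuation.HasExtension.val_map_le_one_iff v w _).2 a.2
    have hb1 : w b ≤ 1 := by
      by_contra! hlt
      have h1 : w (b ^ p) ≤ w b := by
        rw [hb]
        refine (Valuation.map_add _ _ _).trans (max_le ?_ (ha.trans hlt.le))
        rw [map_mul]
        exact mul_le_of_le_one_left' hε.le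
      rw [map_pow] at h1
      exact absurd h1 (not_le.2 (lt_self_pow₀ hlt hprime.one_lt))
    have hsep := htame.separable
    have hβ : (residue w.valuationSubring ⟨b, hb1⟩) ^ p =
        algebraMap (Residue v) (Residue w) (residue _ a) := by
      rw [Valuation.HasExtension.algebraMap_residue_eq_residue_algebraMap, ← map_pow,
        residue_eq_iff]
      show w (b ^ p - algebraMap K E a) < 1
      rw [hb, add_sub_cancel_right, map_mul]
      exact (mul_le_of_le_one_right' hb1).trans_lt hε
    have hmem : residue w.valuationSubring ⟨b, hb1⟩ ∈ perfectClosure (Residue v) (Residue w) :=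
      (mem_perfectClosure_iff_pow_mem p).2 ⟨1, _, by rw [pow_one]; exact hβ.symm⟩
    rw [perfectClosure.eq_bot_of_isSeparable, mem_bot] at hmem
    obtain ⟨g, hg⟩ := hmem
    refine ⟨g, (algebraMap (Residue v) (Residue w)).injective ?_⟩
    rw [frobenius_def, map_pow, hg, hβ]
  exact PerfectRing.toPerfectField _ p

theorem IsTameField.isSeparablyTameField (hv : IsTameField v) : IsSeparablyTameField v :=
  ⟨hv.henselian, fun L _ _ Γ' _ w _ _ ↦ hv.tame L Γ' w inferInstance⟩

end TameBase
end HenselRat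

namespace HenselRat
open IsLocalRing IntermediateField

/-! ### Transfer to immediate and purely inseparable extensions -/

section Transfer

variable {K L : Type*} [Field K] [Field L] [Algebra K L] {Γ Γ' : Type*}
  [LinearOrderedCommGroupWithZero Γ] [LinearOrderedCommGroupWithZero Γ']
  {v : Valuation K Γ} {w : Valuation L Γ'} [v.HasExtension w]

theorem IsImmediate.isResidueCharDivisible (h : IsImmediate v w) (hv : IsResidueCharDivisible v) :
    IsResidueCharDivisible w := by
  intro p hp hwp x
  obtain ⟨c, hc⟩ := ((isImmediate_iff_approxBy v w).1 h).exists_val_eq x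
  have hvp : v (p : K) < 1 := by
    rwa [← Valuation.HasExtension.val_map_lt_one_iff v w, map_natCast]
  obtain ⟨d, hd⟩ := hv p hp hvp c
  refine ⟨algebraMap K L d, ?_⟩
  rwa [← map_pow, ← Valuation.HasExtension.val_map_eq_iff v w, hc, map_pow, map_pow] at hd

theorem IsImmediate.perfectField_residue (h : IsImmediate v w) [PerfectField (Residue v)] :
    PerfectField (Residue w) :=
  PerfectField.of_ringEquiv (RingEquiv.ofBijective (algebraMap (Residue v) (Residue w))
    ⟨(algebraMap (Residue v) (Residue w)).injective, h.residue_surjective⟩)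

/-- The base of an immediate function field is not trivially valued. -/
theorem IsImmediate.exists_val_lt_one (h : IsImmediate v w) (hL : IsFunctionField K L) :
    ∃ ε : K, ε ≠ 0 ∧ v ε < 1 := by
  by_contra! htriv
  have happ := (isImmediate_iff_approxBy v w).1 h
  have hone : ∀ c : K, c ≠ 0 → v c = 1 := by
    intro c hc
    refine le_antisymm ?_ (htriv c hc)
    have := htriv c⁻¹ (inv_ne_zero hc)
    rwa [map_inv₀, one_le_inv₀ (zero_lt_iff.2 (v.ne_zero_iff.2 hc))] at this
  have hw : ∀ x : L, x ≠ 0 → w x = 1 := by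
    intro x hx
    obtain ⟨c, hc⟩ := happ.exists_val_eq x
    have hc0 : c ≠ 0 := by
      rintro rfl
      rw [map_zero, map_zero, eq_comm, Valuation.zero_iff] at hc
      exact hx hc
    rw [← hc, Valuation.HasExtension.val_map_eq_one_iff v w]
    exact hone c hc0
  have hsurj : Function.Surjective (algebraMap K L) := by
    intro x
    rcases eq_or_ne x 0 with rfl | hx
    · exact ⟨0, map_zero _⟩
    obtain ⟨c, hc⟩ := happ x hx
    refine ⟨c, ?_⟩
    by_contra hne
    rw [hw _ (sub_ne_zero.2 (Ne.symm hne)), hw x hx] at hc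
    exact lt_irrefl _ hc
  have : Algebra.IsAlgebraic K L := ⟨fun x ↦ by
    obtain ⟨c, rfl⟩ := hsurj x
    exact isAlgebraic_algebraMap c⟩
  have h1 := hL.one_le_trdeg
  rw [trdeg_eq_zero] at h1
  exact absurd h1 (by simp)

/-- A purely inseparable extension of a valued field with perfect residue field and with
value group divisible by the residue characteristic is immediate. -/
theorem approxBy_of_isPurelyInseparable [IsPurelyInseparable K L] (hv : IsResidueCharDivisible v)
    [PerfectField (Residue v)] : ApproxBy K w := by
  obtain ⟨p, hp⟩ := ExpChar.exists K
  have : ExpChar L p := expChar_of_injective_algebraMap (algebraMap K L).injective p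
  rcases hp with _ | hprime
  · intro x hx
    obtain ⟨n, c, hc⟩ := IsPurelyInseparable.pow_mem K 1 x
    rw [one_pow, pow_one] at hc
    refine ⟨c, ?_⟩
    rw [hc, sub_self, map_zero]
    exact zero_lt_iff.2 (w.ne_zero_iff.2 hx)
  have hvp : v (p : K) < 1 := by simp
  have : Fact p.Prime := ⟨hprime⟩
  have : ExpChar K p := .prime hprime
  have hres : (p : Residue v) = 0 := natCast_residue_eq_zero hvp
  have : CharP (Residue v) p := CharP.ringChar_of_prime_eq_zero hprime hres ▸ ringChar.charP _
  have : ExpChar (Residue v) p := .prime hprime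
  have : PerfectRing (Residue v) p := PerfectField.toPerfectRing p
  -- Induction on $n$: if $c$ approximates $x^p$, divisibility and perfectness give $(dg)^p$
  -- approximating $c$. Frobenius is additive, so $w(x-dg)^p<w(x)^p$.
  have key : ∀ (n : ℕ) (x : L), x ≠ 0 → x ^ p ^ n ∈ (algebraMap K L).range →
      ∃ c : K, w (x - algebraMap K L c) < w x := by
    intro n
    induction n with
    | zero =>
      rintro x hx ⟨c, hc⟩
      rw [pow_zero, pow_one] at hc
      refine ⟨c, ?_⟩
      rw [hc, sub_self, map_zero]
      exact zero_lt_iff.2 (w.ne_zero_iff.2 hx)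
    | succ n ih =>
      intro x hx hmem
      rw [pow_succ', pow_mul] at hmem
      obtain ⟨c, hc⟩ := ih (x ^ p) (pow_ne_zero _ hx) hmem
      have hcx : w (algebraMap K L c) = w (x ^ p) := val_eq_of_sub_lt hc
      have hwxp : w (x ^ p) ≠ 0 := w.ne_zero_iff.2 (pow_ne_zero _ hx)
      have hc0 : c ≠ 0 := by
        rintro rfl
        rw [map_zero, map_zero] at hcx
        exact hwxp hcx.symm
      obtain ⟨d, hd⟩ := hv p hprime hvp c
      have hd0 : d ≠ 0 := by
        rintro rfl
        rw [map_zero, zero_pow hprime.ne_zero, eq_comm, Valuation.zero_iff] at hd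
        exact hc0 hd
      have hu : v (c / d ^ p) ≤ 1 := by
        rw [map_div₀, map_pow, hd, div_self (v.ne_zero_iff.2 hc0)]
      obtain ⟨g, hg⟩ := (PerfectRing.bijective_frobenius (R := Residue v) (p := p)).2
        (residue _ ⟨c / d ^ p, hu⟩)
      obtain ⟨g, rfl⟩ := residue_surjective g
      replace hg : residue v.valuationSubring g ^ p = residue _ ⟨c / d ^ p, hu⟩ := hg
      rw [← map_pow, eq_comm, residue_eq_iff] at hg
      replace hg : v (c / d ^ p - (g : K) ^ p) < 1 := hg
      refine ⟨d * g, ?_⟩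
      have h1 : w (algebraMap K L (c - (d * g) ^ p)) < w (x ^ p) := by
        rw [← hcx, Valuation.HasExtension.val_map_lt_iff v w]
        have : c - (d * g) ^ p = (c / d ^ p - (g : K) ^ p) * d ^ p := by
          rw [mul_pow]; field_simp
        rw [this, map_mul, map_pow, hd]
        exact mul_lt_of_lt_one_left (zero_lt_iff.2 (v.ne_zero_iff.2 hc0)) hg
      have h2 : w (x - algebraMap K L (d * g)) ^ p < w x ^ p := by
        rw [← map_pow, ← map_pow, sub_pow_expChar, ← map_pow]
        have : x ^ p - algebraMap K L ((d * g) ^ p) =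
            (x ^ p - algebraMap K L c) + algebraMap K L (c - (d * g) ^ p) := by
          rw [map_sub]; ring
        rw [this]
        exact Valuation.map_add_lt _ hc h1
      exact lt_of_pow_lt_pow_left₀ _ zero_le h2
  intro x hx
  obtain ⟨n, hn⟩ := IsPurelyInseparable.pow_mem K p x
  exact key n x hx hn

end Transfer

/-! ### Maximal immediate extensions -/

section Maximal

variable {F N : Type u} [Field F] [Field N] [Algebra F N] {Γ Γ' : Type*}
  [LinearOrderedCommGroupWithZero Γ] [LinearOrderedCommGroupWithZero Γ']
  {v : Valuation F Γ} {w : Valuation N Γ'} [v.HasExtension w]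

/-- Algebraicity and immediacy are transitive, so maximality over $F$ becomes a property of $N$
alone. -/
theorem IsMaximalImmediateAlgebraic.surjective (h : IsMaximalImmediateAlgebraic v w)
    (M : Type u) [Field M] [Algebra N M] {Δ : Type u} [LinearOrderedCommGroupWithZero Δ]
    (w' : Valuation M Δ) [hw' : w.HasExtension w'] (halg : Algebra.IsAlgebraic N M)
    (happ : ApproxBy N w') : Function.Surjective (algebraMap N M) := by
  let _ : Algebra F M := ((algebraMap N M).comp (algebraMap F N)).toAlgebra
  have _ : IsScalarTower F N M := .of_algebraMap_eq fun _ ↦ rfl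
  have _ : v.HasExtension w' := hasExtension_trans w
  have := h.algebraic
  refine h.maximal M Δ w' (Algebra.IsAlgebraic.trans F N M) ((isImmediate_iff_approxBy v w').2 ?_)
  exact happ.trans (((isImmediate_iff_approxBy v w).1 h.immediate).isEquiv hw'.val_isEquiv_comap)

theorem IsMaximalImmediateSeparable.surjective (h : IsMaximalImmediateSeparable v w)
    (M : Type u) [Field M] [Algebra N M] {Δ : Type u} [LinearOrderedCommGroupWithZero Δ]
    (w' : Valuation M Δ) [hw' : w.HasExtension w'] (hsep : Algebra.IsSeparable N M)
    (happ : ApproxBy N w') : Function.Surjective (algebraMap N M) := by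
  let _ : Algebra F M := ((algebraMap N M).comp (algebraMap F N)).toAlgebra
  have _ : IsScalarTower F N M := .of_algebraMap_eq fun _ ↦ rfl
  have _ : v.HasExtension w' := hasExtension_trans w
  have := h.separable
  refine h.maximal M Δ w' (Algebra.IsSeparable.trans F N M) ((isImmediate_iff_approxBy v w').2 ?_)
  exact happ.trans (((isImmediate_iff_approxBy v w).1 h.immediate).isEquiv hw'.val_isEquiv_comap)

variable (v) in
-- Every algebraic extension of a subfield of the algebraic closure of $F$ embeds there over it, so
-- maximality inside that closure is absolute.
theorem exists_isMaximalImmediateAlgebraic :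
    ∃ (N : Type u) (_ : Field N) (_ : Algebra F N) (ΓN : Type u)
      (_ : LinearOrderedCommGroupWithZero ΓN) (w : Valuation N ΓN) (_ : v.HasExtension w),
      IsMaximalImmediateAlgebraic v w := by
  obtain ⟨E, A, hA, happ, hmax⟩ := exists_maximal_immediate_subextension (AlgebraicClosure F) v
  refine ⟨E, inferInstance, inferInstance, A.ValueGroup, inferInstance, A.valuation, hA,
    inferInstance, (isImmediate_iff_approxBy v _).2 happ, ?_⟩
  intro M _ _ _ _ Δ _ w' hw' _ halg himm
  have : Algebra.IsAlgebraic E M := Algebra.IsAlgebraic.tower_top (K := F) E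
  exact hmax w' hw' ((isImmediate_iff_approxBy v w').1 himm) IsAlgClosed.lift

variable (v) in
theorem exists_isMaximalImmediateSeparable :
    ∃ (N : Type u) (_ : Field N) (_ : Algebra F N) (ΓN : Type u)
      (_ : LinearOrderedCommGroupWithZero ΓN) (w : Valuation N ΓN) (_ : v.HasExtension w),
      IsMaximalImmediateSeparable v w := by
  obtain ⟨E, A, hA, happ, hmax⟩ := exists_maximal_immediate_subextension (SeparableClosure F) v
  refine ⟨E, inferInstance, inferInstance, A.ValueGroup, inferInstance, A.valuation, hA,
    Algebra.isSeparable_tower_bot_of_isSeparable F E (SeparableClosure F),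
    (isImmediate_iff_approxBy v _).2 happ, ?_⟩
  intro M _ _ _ _ Δ _ w' hw' _ hsep himm
  have : Algebra.IsSeparable E M := Algebra.isSeparable_tower_top_of_isSeparable F E M
  exact hmax w' hw' ((isImmediate_iff_approxBy v w').1 himm) IsSepClosed.lift

theorem IsMaximalImmediateSeparable.isSeparablyTameField (h : IsMaximalImmediateSeparable v w)
    (hv : IsResidueCharDivisible v) [PerfectField (Residue v)] : IsSeparablyTameField w := by
  have := h.immediate.perfectField_residue
  exact isSeparablyTameField_of_maximal (fun M _ _ Δ _ w' _ ↦ h.surjective M w')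
    (h.immediate.isResidueCharDivisible hv)

/-- The perfect closure of $N$ is an immediate extension of $N$, hence equal to $N$. -/
theorem IsMaximalImmediateAlgebraic.perfectField (h : IsMaximalImmediateAlgebraic v w)
    (hv : IsResidueCharDivisible v) [PerfectField (Residue v)] : PerfectField N := by
  have := h.immediate.perfectField_residue
  let M := perfectClosure N (AlgebraicClosure N)
  obtain ⟨A, hA⟩ := exists_hasExtension (L := M) w
  have hsurj := h.surjective M A.valuation inferInstance
    (approxBy_of_isPurelyInseparable (v := w) (h.immediate.isResidueCharDivisible hv))
  refine perfectField_of_perfectClosure_eq_bot N (AlgebraicClosure N) (eq_bot_iff.2 ?_)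
  intro x hx
  obtain ⟨c, hc⟩ := hsurj ⟨x, hx⟩
  exact mem_bot.2 ⟨c, congrArg Subtype.val hc⟩

theorem IsMaximalImmediateAlgebraic.isTameField (h : IsMaximalImmediateAlgebraic v w)
    (hv : IsResidueCharDivisible v) [PerfectField (Residue v)] : IsTameField w := by
  have := h.immediate.perfectField_residue
  have := h.perfectField hv
  have hsep : IsSeparablyTameField w :=
    isSeparablyTameField_of_maximal (fun M _ _ Δ _ w' _ _ ↦ h.surjective M w' inferInstance)
      (h.immediate.isResidueCharDivisible hv)
  exact ⟨hsep.henselian, fun L _ _ Γ' _ w' _ _ ↦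
    hsep.tame L Γ' w' Algebra.IsAlgebraic.isSeparable_of_perfectField⟩

end Maximal
end HenselRat

/-! ### The proposition -/

theorem proposition1p4 {K : Type*} {F : Type u} [Field K] [Field F] [Algebra K F]
    {ΓK ΓF : Type*} [LinearOrderedCommGroupWithZero ΓK] [LinearOrderedCommGroupWithZero ΓF]
    (vK : Valuation K ΓK) (vF : Valuation F ΓF) [vK.HasExtension vF]
    (hF : HenselRat.IsFunctionField K F) (himm : HenselRat.IsImmediate vK vF) :
    (HenselRat.IsTameField vK →
      (∃ (N : Type u) (_ : Field N) (_ : Algebra F N) (ΓN : Type u)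
        (_ : LinearOrderedCommGroupWithZero ΓN) (vN : Valuation N ΓN) (_ : vF.HasExtension vN),
        HenselRat.IsMaximalImmediateAlgebraic vF vN ∧
        HenselRat.IsImmediate vF vN ∧ HenselRat.IsTameField vN) ∧
      (∀ (N : Type u) [Field N] [Algebra F N] (ΓN : Type u)
        [LinearOrderedCommGroupWithZero ΓN] (vN : Valuation N ΓN) [vF.HasExtension vN],
        HenselRat.IsMaximalImmediateAlgebraic vF vN → HenselRat.IsTameField vN)) ∧
    (HenselRat.IsSeparablyTameField vK → HenselRat.IsSeparablyGenerated K F →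
      (∃ (N : Type u) (_ : Field N) (_ : Algebra F N) (ΓN : Type u)
        (_ : LinearOrderedCommGroupWithZero ΓN) (vN : Valuation N ΓN) (_ : vF.HasExtension vN),
        HenselRat.IsMaximalImmediateSeparable vF vN ∧
        Algebra.IsSeparable F N ∧ HenselRat.IsImmediate vF vN ∧
        HenselRat.IsSeparablyTameField vN) ∧
      (∀ (N : Type u) [Field N] [Algebra F N] (ΓN : Type u)
        [LinearOrderedCommGroupWithZero ΓN] (vN : Valuation N ΓN) [vF.HasExtension vN],
        HenselRat.IsMaximalImmediateSeparable vF vN → HenselRat.IsSeparablyTameField vN)) := by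
  have hnt := himm.exists_val_lt_one hF
  have key : HenselRat.IsSeparablyTameField vK → HenselRat.IsResidueCharDivisible vF ∧
      PerfectField (HenselRat.Residue vF) := fun hK ↦
    have := hK.perfectField_residue hnt
    ⟨himm.isResidueCharDivisible (hK.isResidueCharDivisible hnt), himm.perfectField_residue⟩
  refine ⟨fun hK ↦ ?_, fun hK _ ↦ ?_⟩
  · obtain ⟨hdiv, _⟩ := key hK.isSeparablyTameField
    refine ⟨?_, fun N _ _ ΓN _ vN _ h ↦ h.isTameField hdiv⟩
    obtain ⟨N, _, _, ΓN, _, vN, _, h⟩ := HenselRat.exists_isMaximalImmediateAlgebraic vF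
    exact ⟨N, _, _, ΓN, _, vN, _, h, h.immediate, h.isTameField hdiv⟩
  · obtain ⟨hdiv, _⟩ := key hK
    refine ⟨?_, fun N _ _ ΓN _ vN _ h ↦ h.isSeparablyTameField hdiv⟩
    obtain ⟨N, _, _, ΓN, _, vN, _, h⟩ := HenselRat.exists_isMaximalImmediateSeparable vF
    exact ⟨N, _, _, ΓN, _, vN, _, h, h.separable, h.immediate, h.isSeparablyTameField hdiv⟩
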